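/- Let $\Phi\subset\mathfrak h^*$ be a (finite, crystallographic, reduced) root system over $\mathbb C$, for instance the root system of a finite-dimensional complex semisimple Lie algebra with Cartan subalgebra $\mathfrak h$; let $\Pi$ be a base of $\Phi$, $\Phi^+$ the positive roots, $W$ the Weyl group, $\ell$ its length function with respect to the simple reflections $s_\alpha$ ($\alpha\in\Pi$), and $w_0$ the longest element of $W$. Let $R=S(\mathfrak h^*)$, let $I_W\subset R$ be the ideal generated by the homogeneous $W$-invariants of positive degree, and let $C=R/I_W$ be the coinvariant algebra, $\mathbb Z$-graded with $\mathfrak h^*$ in degree $2$. For $\alpha\in\Pi$ let $\Delta_{s_\alpha}(f)=(f-s_\alpha f)/\alpha$ on $R$, and $\Delta_w=\Delta_{s_1}\cdots\Delta_{s_k}$ for a reduced expression $w=s_1\cdots s_k$. Put $D=\frac1{|W|}\prod_{\alpha\in\Phi^+}\alpha$ and let $X_w\in C$ be the image of $\Delta_{w^{-1}w_0}D$ (the Schubert class of $w\in W$). A graded cell datum for a $\mathbb Z$-graded algebra $A$, finite free over $K$, consists of a poset $(\Lambda,\rhd)$, finite sets $T(\lambda)$ ($\lambda\in\Lambda$),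 elements $c^\lambda_{st}\in A$ ($s,t\in T(\lambda)$) that form a $K$-basis of $A$, and a function $\deg:\bigsqcup_\lambda T(\lambda)\to\mathbb Z$, such that: $c^\lambda_{st}$ is homogeneous of degree $\deg s+\deg t$; for all $t\in T(\lambda)$ and $a\in A$ there are scalars $r_{tv}(a)$, independent of $s$, with $c^\lambda_{st}a\equiv\sum_{v\in T(\lambda)}r_{tv}(a)c^\lambda_{sv}$ modulo the span of the $c^\mu_{uv}$ with $\mu\rhd\lambda$; and the linear map with $c^\lambda_{st}\mapsto c^\lambda_{ts}$ is an anti-isomorphism of $A$. The cell module of $\lambda$ is the right $A$-module with $K$-basis $(c_t)_{t\in T(\lambda)}$ and action $c_ta=\sum_v r_{tv}(a)c_v$. Then: 1) $\{X_w\mid w\in W\}$ is a graded cellular basis of the $\mathbb Z$-graded algebra $C$, with one-dimensional cell modules. More precisely, there are a partial order on $W$ and a graded cell datum for $C$ with weight poset $W$ such that, for every $w\in W$, the set $T(w)$ has one element $t$, $\deg t=\ell(w)$, $c^w_{tt}=X_w$, and the cell module of $w$ is one-dimensional over $\mathbb C$. 2) The assignment $X_w\mapsto\delta_{w,w_0}$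 ($w\in W$) extends to a unique linear form $\mathrm{tr}:C\to\mathbb C$. This form is a symmetrizing form, that is, $\mathrm{tr}(ab)=\mathrm{tr}(ba)$ and the bilinear form $(a,b)\mapsto\mathrm{tr}(ab)$ is non-degenerate. It is homogeneous of degree $-2\ell(w_0)$, that is, $\mathrm{tr}$ vanishes on the degree-$k$ component of $C$ for every $k\neq 2\ell(w_0)$. -/

import Mathlib

noncomputable section

/-! ### Graded algebras, graded cellular bases, symmetrizing forms -/

/-- The family `𝒜` of subspaces is a `ℤ`-grading of the `K`-algebra `A`: `1` is homogeneous of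
degree `0`, products of homogeneous elements are homogeneous of the sum of the degrees, and `A` is
the internal direct sum of the homogeneous components. -/
def IsAlgebraGrading {K A : Type*} [CommRing K] [Ring A] [Algebra K A]
    (𝒜 : ℤ → Submodule K A) : Prop :=
  SetLike.GradedMonoid 𝒜 ∧ DirectSum.IsInternal 𝒜

/-- A graded cell datum `(Λ, T, c, deg)` for the `ℤ`-graded algebra `A = ⨁ 𝒜 d`, which is finite
free over `K` (freeness is witnessed by the cellular basis). The weight poset is `Λ`, with
`μ ▷ l` written `l < μ`. -/
structure GradedCellDatum {K A : Type*} [CommRing K] [Ring A] [Algebra K A]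
    (𝒜 : ℤ → Submodule K A) (Λ : Type*) [PartialOrder Λ] where
  isGrading : IsAlgebraGrading 𝒜
  moduleFinite : Module.Finite K A
  T : Λ → Type
  finiteT : ∀ l, Finite (T l)
  c : ∀ l, T l → T l → A
  deg : ∀ l, T l → ℤ
  /-- Each basis element `c l s t` is homogeneous of degree `deg s + deg t`. -/
  c_mem : ∀ l s t, c l s t ∈ 𝒜 (deg l s + deg l t)
  /-- The elements `c l s t` form a basis of `A`. -/
  linearIndependent_c :
    LinearIndependent K (fun x : (l : Λ) × (T l × T l) => c x.1 x.2.1 x.2.2)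
  span_c : Submodule.span K
    (Set.range (fun x : (l : Λ) × (T l × T l) => c x.1 x.2.1 x.2.2)) = ⊤
  /-- `c l s t * a ≡ ∑ v, r t v (a) • c l s v` modulo the span of the `c μ _ _` with `μ ▷ l`,
  where the scalars `r t v (a)` do not depend on `s`. -/
  c_mul : ∀ (l : Λ) (t : T l) (a : A), ∃ r : T l → K, ∀ s : T l,
    c l s t * a - ∑ᶠ v, r v • c l s v ∈
      Submodule.span K {x : A | ∃ μ, l < μ ∧ ∃ u v : T μ, x = c μ u v}
  /-- The linear map with `c l s t ↦ c l t s` is an anti-isomorphism (it is bijective since its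
  square is the identity). -/
  anti : ∃ star : A →ₗ[K] A, (∀ l s t, star (c l s t) = c l t s) ∧
    ∀ a b, star (a * b) = star b * star a

namespace GradedCellDatum

variable {K A : Type*} [CommRing K] [Ring A] [Algebra K A]
  {𝒜 : ℤ → Submodule K A} {Λ : Type*} [PartialOrder Λ] (D : GradedCellDatum 𝒜 Λ)

/-- The cellular basis as a Mathlib basis. -/
def basis : Module.Basis ((l : Λ) × (D.T l × D.T l)) K A :=
  Module.Basis.mk D.linearIndependent_c D.span_c.ge

lemma basis_apply (l : Λ) (s t : D.T l) : D.basis ⟨l, s, t⟩ = D.c l s t := by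
  simp [basis]

/-- The span of the basis elements `c μ u v` with `μ ▷ l`. -/
def above (l : Λ) : Submodule K A :=
  Submodule.span K {x : A | ∃ μ, l < μ ∧ ∃ u v : D.T μ, x = D.c μ u v}

/-- The structure constant `r t v (a)` of the right action of `a` on the cell module: the
coefficient of `c l t v` in `c l t t * a`. -/
def coeff (l : Λ) (a : A) (t v : D.T l) : K := D.basis.repr (D.c l t t * a) ⟨l, t, v⟩

lemma repr_above {l : Λ} {x : A} (hx : x ∈ D.above l) (s v : D.T l) :
    D.basis.repr x ⟨l, s, v⟩ = 0 := by
  classical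
  induction hx using Submodule.span_induction with
  | mem x h =>
    obtain ⟨μ, hμ, u, w, rfl⟩ := h
    rw [← D.basis_apply, Module.Basis.repr_self, Finsupp.single_apply, if_neg]
    intro h
    exact hμ.ne (congrArg Sigma.fst h).symm
  | zero => simp
  | add x y _ _ hx hy => simp [hx, hy]
  | smul r x _ hx => simp [hx]

lemma repr_of_congr {l : Λ} {s : D.T l} {x : A} {r : D.T l → K}
    (h : x - ∑ᶠ v, r v • D.c l s v ∈ D.above l) (v : D.T l) :
    D.basis.repr x ⟨l, s, v⟩ = r v := by
  classical
  have := D.finiteT l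
  have := Fintype.ofFinite (D.T l)
  have h0 := D.repr_above h s v
  rw [finsum_eq_sum_of_fintype, map_sub, Finsupp.sub_apply, sub_eq_zero] at h0
  rw [h0]
  simp [← D.basis_apply, Finsupp.single_apply]

/-- The congruence of the cell datum, with the scalars identified as `coeff`. -/
lemma c_mul_sub_mem (l : Λ) (s t : D.T l) (a : A) :
    D.c l s t * a - ∑ᶠ v, D.coeff l a t v • D.c l s v ∈ D.above l := by
  obtain ⟨r, hr⟩ := D.c_mul l t a
  have h : D.coeff l a t = r := funext fun v => D.repr_of_congr (hr t) v
  rw [h]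
  exact hr s

lemma above_mul {l : Λ} {x : A} (hx : x ∈ D.above l) (a : A) : x * a ∈ D.above l := by
  induction hx using Submodule.span_induction with
  | mem x h =>
    obtain ⟨μ, hμ, u, w, rfl⟩ := h
    have := D.finiteT μ
    have := Fintype.ofFinite (D.T μ)
    have h1 := D.c_mul_sub_mem μ u w a
    rw [finsum_eq_sum_of_fintype] at h1
    have h2 : D.above μ ≤ D.above l := Submodule.span_mono (by
      rintro x ⟨ν, hν, h⟩
      exact ⟨ν, hμ.trans hν, h⟩)
    have h3 : ∑ v, D.coeff μ a w v • D.c μ u v ∈ D.above l :=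
      Submodule.sum_mem _ fun v _ => Submodule.smul_mem _ _
        (Submodule.subset_span ⟨μ, hμ, u, v, rfl⟩)
    simpa using Submodule.add_mem _ (h2 h1) h3
  | zero => simp
  | add x y _ _ hx hy => rw [add_mul]; exact Submodule.add_mem _ hx hy
  | smul r x _ hx => rw [smul_mul_assoc]; exact Submodule.smul_mem _ _ hx

lemma coeff_one (l : Λ) (t v : D.T l) [DecidableEq (D.T l)] :
    D.coeff l 1 t v = if t = v then 1 else 0 := by
  classical
  simp [coeff, ← D.basis_apply, Finsupp.single_apply]

lemma coeff_add (l : Λ) (a b : A) (t v : D.T l) :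
    D.coeff l (a + b) t v = D.coeff l a t v + D.coeff l b t v := by
  simp [coeff, mul_add]

lemma coeff_mul [∀ l, Fintype (D.T l)] (l : Λ) (a b : A) (t v : D.T l) :
    D.coeff l (a * b) t v = ∑ u, D.coeff l a t u * D.coeff l b u v := by
  have h1 := D.above_mul (D.c_mul_sub_mem l t t a) b
  have h2 : ∀ u, D.c l t u * b - ∑ v, D.coeff l b u v • D.c l t v ∈ D.above l := fun u => by
    simpa [finsum_eq_sum_of_fintype] using D.c_mul_sub_mem l t u b
  have h3 : ∑ u, D.coeff l a t u • (D.c l t u * b - ∑ v, D.coeff l b u v • D.c l t v) ∈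
      D.above l := Submodule.sum_mem _ fun u _ => Submodule.smul_mem _ _ (h2 u)
  have h4 := Submodule.add_mem _ h1 h3
  refine D.repr_of_congr (r := fun v => ∑ u, D.coeff l a t u * D.coeff l b u v) ?_ v
  convert h4 using 1
  simp only [finsum_eq_sum_of_fintype, sub_mul, Finset.sum_mul, smul_mul_assoc, smul_sub,
    Finset.sum_sub_distrib, Finset.smul_sum, Finset.sum_smul, smul_smul, mul_assoc]
  rw [Finset.sum_comm (γ := D.T l)]
  abel

/-- The cell module of weight `l`: the free `K`-module with basis `(c t)`, `t ∈ T l`. -/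
def CellModule (l : Λ) : Type _ := D.T l →₀ K

instance (l : Λ) : AddCommGroup (D.CellModule l) := inferInstanceAs (AddCommGroup (D.T l →₀ K))

instance (l : Λ) : Module K (D.CellModule l) := inferInstanceAs (Module K (D.T l →₀ K))

/-- The basis `(c t)` of the cell module. -/
def cellBasis (l : Λ) : Module.Basis (D.T l) K (D.CellModule l) :=
  Finsupp.basisSingleOne

/-- The right action of `a` on the cell module: `c t · a = ∑ v, r t v (a) • c v`. -/
def cellAct (l : Λ) (a : A) : D.CellModule l →ₗ[K] D.CellModule l :=
  (D.cellBasis l).constr K fun t => ∑ᶠ v, D.coeff l a t v • D.cellBasis l v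

lemma cellAct_basis (l : Λ) (a : A) (t : D.T l) :
    D.cellAct l a (D.cellBasis l t) = ∑ᶠ v, D.coeff l a t v • D.cellBasis l v :=
  (D.cellBasis l).constr_basis K _ t

lemma cellAct_one (l : Λ) : D.cellAct l 1 = LinearMap.id := by
  classical
  have := D.finiteT l
  have := Fintype.ofFinite (D.T l)
  refine (D.cellBasis l).ext fun t => ?_
  simp [cellAct_basis, finsum_eq_sum_of_fintype, coeff_one]

lemma cellAct_add (l : Λ) (a b : A) : D.cellAct l (a + b) = D.cellAct l a + D.cellAct l b := by
  have := D.finiteT l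
  have := Fintype.ofFinite (D.T l)
  refine (D.cellBasis l).ext fun t => ?_
  simp [cellAct_basis, finsum_eq_sum_of_fintype, coeff_add, add_smul, Finset.sum_add_distrib]

lemma cellAct_mul (l : Λ) (a b : A) : D.cellAct l (a * b) = D.cellAct l b ∘ₗ D.cellAct l a := by
  have := D.finiteT
  have := fun m => Fintype.ofFinite (D.T m)
  refine (D.cellBasis l).ext fun t => ?_
  simp only [LinearMap.comp_apply, cellAct_basis, finsum_eq_sum_of_fintype, map_sum, map_smul,
    coeff_mul, Finset.sum_smul, Finset.smul_sum, smul_smul]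
  exact Finset.sum_comm

/-- The cell module is a right `A`-module. -/
instance (l : Λ) : Module Aᵐᵒᵖ (D.CellModule l) where
  smul a x := D.cellAct l a.unop x
  one_smul x := by
    change D.cellAct l 1 x = x
    rw [cellAct_one]; rfl
  mul_smul a b x := by
    change D.cellAct l (b.unop * a.unop) x = D.cellAct l a.unop (D.cellAct l b.unop x)
    rw [cellAct_mul]; rfl
  smul_zero a := map_zero (D.cellAct l a.unop)
  smul_add a := map_add (D.cellAct l a.unop)
  add_smul a b x := by
    change D.cellAct l (a.unop + b.unop) x = D.cellAct l a.unop x + D.cellAct l b.unop x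
    rw [cellAct_add]; rfl
  zero_smul x := by
    change D.cellAct l 0 x = 0
    have h := D.cellAct_add l 0 0
    rw [add_zero] at h
    rw [left_eq_add.mp h]; rfl

end GradedCellDatum

/-- A symmetrizing form on an algebra over a field: a linear form `τ` with `τ (ab) = τ (ba)` such
that the bilinear form `(a, b) ↦ τ (ab)` is non-degenerate. -/
def IsSymmetrizingForm {K A : Type*} [Field K] [Ring A] [Algebra K A] (τ : A →ₗ[K] K) : Prop :=
  (∀ a b, τ (a * b) = τ (b * a)) ∧ ∀ a, (∀ b, τ (a * b) = 0) → a = 0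

/-- The linear form `τ` is homogeneous of degree `d`, the field being concentrated in degree `0`:
it sends the degree `k` component to the degree `k + d` component of `K`. -/
def IsHomogeneousForm {K A : Type*} [Field K] [Ring A] [Algebra K A] (𝒜 : ℤ → Submodule K A)
    (τ : A →ₗ[K] K) (d : ℤ) : Prop :=
  ∀ k : ℤ, k + d ≠ 0 → ∀ a ∈ 𝒜 k, τ a = 0

/-! ### The coinvariant algebra and its Schubert classes -/

namespace RootPairing

variable {ι V V' : Type*} [AddCommGroup V] [Module ℂ V] [AddCommGroup V'] [Module ℂ V']

section Coinvariants

variable (P : RootPairing ι ℂ V V')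

/-- The action of an element of the Weyl group on `S(V)` by algebra automorphisms, extending its
action on `V`. -/
def weylSym (w : P.weylGroup) : SymmetricAlgebra ℂ V →ₐ[ℂ] SymmetricAlgebra ℂ V :=
  SymmetricAlgebra.lift (SymmetricAlgebra.ι ℂ V ∘ₗ P.weylGroupRootRep w)

/-- The `j`-th symmetric power `S_j(V)` inside `S(V)`. -/
def symPower (V : Type*) [AddCommGroup V] [Module ℂ V] (j : ℕ) :
    Submodule ℂ (SymmetricAlgebra ℂ V) :=
  LinearMap.range (SymmetricAlgebra.ι ℂ V) ^ j

/-- The ideal `I_W` of `S(V)` generated by the homogeneous `W`-invariants of positive degree. -/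
def coinvariantIdeal : Ideal (SymmetricAlgebra ℂ V) :=
  Ideal.span {f | ∃ j : ℕ, 1 ≤ j ∧ f ∈ symPower V j ∧ ∀ w : P.weylGroup, P.weylSym w f = f}

/-- The coinvariant algebra `C = S(V) / I_W`. -/
abbrev Coinvariant : Type _ := SymmetricAlgebra ℂ V ⧸ P.coinvariantIdeal

/-- The grading of `C` with `V` in degree `2`: the component of degree `2j` is the image of
`S_j(V)`, and the components of odd and of negative degree vanish. -/
def coinvariantGrading (k : ℤ) : Submodule ℂ P.Coinvariant :=
  ⨆ (j : ℕ) (_ : 2 * (j : ℤ) = k),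
    (symPower V j).map (Ideal.Quotient.mkₐ ℂ P.coinvariantIdeal).toLinearMap

lemma dvd_sub_weylSym (i : ι) (f : SymmetricAlgebra ℂ V) :
    SymmetricAlgebra.ι ℂ V (P.root i) ∣ f - P.weylSym (weylGroup.ofIdx P i) f := by
  induction f using SymmetricAlgebra.induction with
  | algebraMap r => simp
  | ι x =>
    have h : P.weylSym (weylGroup.ofIdx P i) (SymmetricAlgebra.ι ℂ V x) =
        SymmetricAlgebra.ι ℂ V (P.reflection i x) := by
      rw [weylSym, SymmetricAlgebra.lift_ι_apply]
      rfl
    rw [h, P.reflection_apply, map_sub, sub_sub_cancel, map_smul]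
    exact Dvd.intro_left _ (by rw [Algebra.smul_def])
  | mul a b ha hb =>
    have h : a * b - P.weylSym (weylGroup.ofIdx P i) (a * b) =
        (a - P.weylSym (weylGroup.ofIdx P i) a) * b +
          P.weylSym (weylGroup.ofIdx P i) a * (b - P.weylSym (weylGroup.ofIdx P i) b) := by
      rw [map_mul]; ring
    rw [h]
    exact dvd_add (ha.mul_right _) (hb.mul_left _)
  | add a b ha hb =>
    rw [map_add, add_sub_add_comm]
    exact dvd_add ha hb

/-- The Demazure operator `f ↦ (f - s_α f) / α` of the root `α` with index `i`. -/
def demazureRoot (i : ι) (f : SymmetricAlgebra ℂ V) : SymmetricAlgebra ℂ V :=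
  (P.dvd_sub_weylSym i f).choose

end Coinvariants

namespace Base

variable {P : RootPairing ι ℂ V V'} (b : P.Base)

/-- The product in the Weyl group of a word in the simple reflections. -/
def wordProd (l : List b.support) : P.weylGroup :=
  (l.map fun i => weylGroup.ofIdx P (i : ι)).prod

/-- The length of an element of the Weyl group with respect to the simple reflections. -/
def length (w : P.weylGroup) : ℕ :=
  sInf {n | ∃ l : List b.support, b.wordProd l = w ∧ l.length = n}

/-- The composite `Δ_{s₁} ⋯ Δ_{sₖ}` of the Demazure operators along a word `s₁ ⋯ sₖ`. -/
def demazureWord (l : List b.support) (f : SymmetricAlgebra ℂ V) : SymmetricAlgebra ℂ V :=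
  l.foldr (fun i g => P.demazureRoot (i : ι) g) f

variable [Fintype ι] [P.IsCrystallographic] [P.IsReduced]

lemma exists_wordProd_eq (w : P.weylGroup) : ∃ l : List b.support, b.wordProd l = w := by
  have hmul : ∀ l l' : List b.support, b.wordProd (l ++ l') = b.wordProd l * b.wordProd l' := by
    intro l l'
    simp [wordProd]
  have key : ∀ i : ι, ∃ l : List b.support, b.wordProd l = weylGroup.ofIdx P i := by
    have hinj : ∀ g h : P.weylGroup, (∀ x : V, g • x = h • x) → g = h := by
      intro g h hgh
      refine Subtype.ext (Equiv.weightHom_injective P ?_)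
      exact LinearEquiv.ext hgh
    intro i
    refine b.induction_reflect i
      (p := fun i => ∃ l : List b.support, b.wordProd l = weylGroup.ofIdx P i) ?_ ?_ ?_
    · rintro j ⟨l, hl⟩
      refine ⟨l, hl.trans (hinj _ _ fun x => ?_)⟩
      simp only [weylGroup.ofIdx_smul, Equiv.reflection_smul]
      rw [P.reflection_reflectionPerm]
      simp
    · intro j hj
      exact ⟨[⟨j, hj⟩], by simp [wordProd]⟩
    · rintro j k ⟨l, hl⟩ hk
      have h1 : b.wordProd [⟨k, hk⟩] = weylGroup.ofIdx P k := by simp [wordProd]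
      refine ⟨[⟨k, hk⟩] ++ l ++ [⟨k, hk⟩], ?_⟩
      rw [hmul, hmul, h1, hl]
      refine hinj _ _ fun x => ?_
      simp only [mul_smul, weylGroup.ofIdx_smul, Equiv.reflection_smul]
      rw [P.reflection_reflectionPerm]
      simp
  obtain ⟨w, hw⟩ := w
  induction hw using weylGroup.induction with
  | mem i => exact key i
  | one => exact ⟨[], rfl⟩
  | mul x y hx hy ihx ihy =>
    obtain ⟨l, hl⟩ := ihx
    obtain ⟨l', hl'⟩ := ihy
    exact ⟨l ++ l', by rw [hmul, hl, hl']; rfl⟩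

lemma exists_reducedWord (w : P.weylGroup) :
    ∃ l : List b.support, b.wordProd l = w ∧ l.length = b.length w :=
  Nat.sInf_mem (s := {n | ∃ l : List b.support, b.wordProd l = w ∧ l.length = n})
    (let ⟨l, hl⟩ := b.exists_wordProd_eq w; ⟨l.length, l, hl, rfl⟩)

/-- A reduced expression of `w`. -/
def reducedWord (w : P.weylGroup) : List b.support := (b.exists_reducedWord w).choose

/-- The Demazure operator `Δ_w = Δ_{s₁} ⋯ Δ_{sₖ}` for a reduced expression `w = s₁ ⋯ sₖ`. -/
def demazure (w : P.weylGroup) : SymmetricAlgebra ℂ V → SymmetricAlgebra ℂ V :=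
  b.demazureWord (b.reducedWord w)

open Classical in
/-- The element `D = |W|⁻¹ ∏_{α > 0} α` of `S(V)`. -/
def topElement : SymmetricAlgebra ℂ V :=
  (Nat.card P.weylGroup : ℂ)⁻¹ •
    ∏ i ∈ Finset.univ.filter (fun i => b.IsPos i), SymmetricAlgebra.ι ℂ V (P.root i)

/-- The Schubert class `X_w = Δ_{w⁻¹ w₀} D` in the coinvariant algebra, where `w₀` is the longest
element of the Weyl group. -/
def schubert (w₀ w : P.weylGroup) : P.Coinvariant :=
  Ideal.Quotient.mk P.coinvariantIdeal (b.demazure (w⁻¹ * w₀) b.topElement)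

end Base

end RootPairing

end

/-! Let ε be evaluation at 0 on S(V), and consider the forms ε ∘ Δ_{s₁}⋯Δ_{sₖ} for all words in the
simple reflections. Everything rests on two facts.

(1) The composite along a word depends only on the length and the product of the word
(`wordEnd_congr`), and it vanishes on non-reduced words (`wordEnd_eq_zero`). Instead of checking
braid relations, one moves multiplication by x ∈ V past the composite: the error terms are
composites along words with one letter deleted. Their sum can be rewritten as a sum over all roots
that sees only the product of the word (`sum_deletions`), so induction on the length applies.

(2) I_W is the common kernel of these forms (`mem_coinvariantIdeal_iff`).

Hence the forms ε_w, w ∈ W, separate the points of C, and ε_w lives in degree 2ℓ(w). Since ℓ(v) +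
ℓ(v⁻¹w₀) = ℓ(w₀), one gets ε_v(X_u) = c δ_{uv} with c = ε(Δ_{w₀} D), and c ≠ 0 because the product
of the positive roots is not in I_W (`posProd_notMem_coinvariantIdeal`). So the X_w form a basis
with dual basis c⁻¹ε_w; the value of c is never needed. Cellularity for the order by length is a
degree argument: a ∈ C acts on X_w by its constant term, up to classes of greater length. The trace
is c⁻¹ε_{w₀}. Each Δ_s is self-adjoint for it, so pairing x with Δ_{v⁻¹} D recovers ε_v(x), whence
non-degeneracy. -/

namespace RootPairing

variable {ι V V' : Type*} [AddCommGroup V] [Module ℂ V] [AddCommGroup V'] [Module ℂ V']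

/-! ### The Weyl group acting on vectors and on root indices. -/

section WeylGroup

variable (P : RootPairing ι ℂ V V')

lemma weylGroup_ext {g h : P.weylGroup} (H : ∀ x : V, g • x = h • x) : g = h :=
  Subtype.ext (Equiv.weightHom_injective P (LinearEquiv.ext H))

lemma ofIdx_smul_index (i j : ι) : weylGroup.ofIdx P i • j = P.reflectionPerm i j := rfl

lemma ofIdx_smul_vec (i : ι) (x : V) : weylGroup.ofIdx P i • x = P.reflection i x := rfl

lemma root_weyl_smul (w : P.weylGroup) (i : ι) : P.root (w • i) = w • P.root i :=
  (P.weylGroup_apply_root w i).symm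

lemma coroot'_weyl_smul (w : P.weylGroup) (i : ι) (x : V) :
    P.coroot' (w • i) (w • x) = P.coroot' i x := by
  obtain ⟨w, hw⟩ := w
  induction hw using weylGroup.induction generalizing i x with
  | mem j =>
    change P.coroot' (P.reflectionPerm j i) (P.reflection j x) = _
    simp [coroot'_reflectionPerm]
  | one =>
    change P.coroot' ((1 : P.weylGroup) • i) ((1 : P.weylGroup) • x) = _
    simp
  | mul g h hg hh ihg ihh =>
    have : (⟨g * h, mul_mem hg hh⟩ : P.weylGroup) = ⟨g, hg⟩ * ⟨h, hh⟩ := rfl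
    rw [this, mul_smul, mul_smul, ihg, ihh]

lemma ofIdx_weyl_smul (w : P.weylGroup) (i : ι) :
    weylGroup.ofIdx P (w • i) = w * weylGroup.ofIdx P i * w⁻¹ := by
  refine P.weylGroup_ext fun x => ?_
  obtain ⟨y, rfl⟩ : ∃ y, x = w • y := ⟨w⁻¹ • x, by simp⟩
  simp only [mul_smul, inv_smul_smul, ofIdx_smul_vec, P.reflection_apply, coroot'_weyl_smul,
    root_weyl_smul, smul_sub]
  congr 1
  exact (LinearMap.map_smul (P.weylGroupRootRep w) _ _).symm

lemma ofIdx_mul_self (i : ι) : weylGroup.ofIdx P i * weylGroup.ofIdx P i = 1 :=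
  P.weylGroup_ext fun x => by simp [mul_smul]

lemma ofIdx_inv (i : ι) : (weylGroup.ofIdx P i)⁻¹ = weylGroup.ofIdx P i :=
  inv_eq_of_mul_eq_one_left (P.ofIdx_mul_self i)

lemma ofIdx_reflectionPerm_self (i : ι) :
    weylGroup.ofIdx P (P.reflectionPerm i i) = weylGroup.ofIdx P i := by
  rw [← P.ofIdx_smul_index, P.ofIdx_weyl_smul, mul_inv_cancel_right]

lemma root_reflectionPerm_self (i : ι) : P.root (P.reflectionPerm i i) = -P.root i := by
  rw [root_reflectionPerm, reflection_apply_self]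

lemma coroot'_reflectionPerm_self (i : ι) (x : V) :
    P.coroot' (P.reflectionPerm i i) x = -P.coroot' i x := by
  rw [coroot'_reflectionPerm, LinearMap.comp_apply, LinearEquiv.coe_coe, P.reflection_apply,
    map_sub, map_smul, root_coroot'_eq_pairing, pairing_same, smul_eq_mul]
  ring

lemma weyl_smul_reflectionPerm_self (w : P.weylGroup) (i : ι) :
    w • P.reflectionPerm i i = P.reflectionPerm (w • i) (w • i) := by
  apply P.root.injective
  rw [root_weyl_smul, root_reflectionPerm_self, root_reflectionPerm_self, root_weyl_smul]
  exact LinearMap.map_neg (P.weylGroupRootRep w) _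

/-- The roots span V, so an element is determined by its permutation of the finite index set. -/
lemma finite_weylGroup [Finite ι] [P.IsRootSystem] : Finite P.weylGroup := by
  refine Finite.of_injective (fun (w : P.weylGroup) (i : ι) => w • i) fun g h hgh => ?_
  refine P.weylGroup_ext fun x => ?_
  have h1 : P.weylGroupRootRep g = P.weylGroupRootRep h := by
    refine LinearMap.ext_on_range (v := P.root) IsRootSystem.span_root_eq_top fun i => ?_
    change g • P.root i = h • P.root i
    rw [← root_weyl_smul, ← root_weyl_smul, show g • i = h • i from congrFun hgh i]
  exact LinearMap.congr_fun h1 x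

end WeylGroup

/-! ### Signs of roots, deletions in words, and the length function. -/

namespace Base

variable {P : RootPairing ι ℂ V V'} (b : P.Base)

/-- The sign of a root: `1` for positive roots and `-1` for negative roots. -/
noncomputable def rootSign (i : ι) : ℤ := if 0 < b.height i then 1 else -1

lemma rootSign_eq (i : ι) : b.rootSign i = 1 ∨ b.rootSign i = -1 := by
  unfold rootSign; split_ifs <;> simp

lemma rootSign_mul_self (i : ι) : b.rootSign i * b.rootSign i = 1 := by
  rcases b.rootSign_eq i with h | h <;> simp [h]

lemma rootSign_eq_one_iff {i : ι} : b.rootSign i = 1 ↔ b.IsPos i := by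
  unfold rootSign IsPos; split_ifs <;> simp_all

lemma rootSign_neg (i : ι) : b.rootSign (P.reflectionPerm i i) = -b.rootSign i := by
  have h1 := b.height_reflectionPerm_self i
  have h2 := b.height_ne_zero i
  simp only [indexNeg_neg] at h1
  unfold rootSign
  split_ifs <;> first | rfl | omega

lemma rootSign_of_mem {i : ι} (h : i ∈ b.support) : b.rootSign i = 1 :=
  b.rootSign_eq_one_iff.2 (isPos_of_mem_support h)

@[simp] lemma wordProd_nil : b.wordProd [] = 1 := rfl

@[simp] lemma wordProd_cons (s : b.support) (l : List b.support) :
    b.wordProd (s :: l) = weylGroup.ofIdx P (s : ι) * b.wordProd l := by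
  simp [wordProd]

lemma wordProd_append (l l' : List b.support) :
    b.wordProd (l ++ l') = b.wordProd l * b.wordProd l' := by
  simp [wordProd]

lemma wordProd_reverse (l : List b.support) : b.wordProd l.reverse = (b.wordProd l)⁻¹ := by
  induction l with
  | nil => simp
  | cons s l ih => simp [wordProd_append, ih, P.ofIdx_inv]

lemma length_wordProd_le (l : List b.support) : b.length (b.wordProd l) ≤ l.length :=
  Nat.sInf_le ⟨l, rfl, rfl⟩

/-- The pairs `(β, l')` where `l'` arises from the word `l` by deleting one letter and `β` is the
corresponding root, so that the product of `l'` is that of `l` times the reflection in `β`. -/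
noncomputable def deletions : List b.support → List (ι × List b.support)
  | [] => []
  | s :: l => ((b.wordProd l)⁻¹ • (s : ι), l) :: (deletions l).map fun p => (p.1, s :: p.2)

lemma length_of_mem_deletions {l : List b.support} {p : ι × List b.support}
    (hp : p ∈ b.deletions l) : p.2.length + 1 = l.length := by
  induction l generalizing p with
  | nil => simp [deletions] at hp
  | cons s l ih =>
    simp only [deletions, List.mem_cons, List.mem_map] at hp
    rcases hp with rfl | ⟨q, hq, rfl⟩
    · simp
    · simp [ih hq]

lemma length_deletions (l : List b.support) : (b.deletions l).length = l.length := by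
  induction l with
  | nil => rfl
  | cons s l ih => simp [deletions, ih]

lemma wordProd_of_mem_deletions {l : List b.support} {p : ι × List b.support}
    (hp : p ∈ b.deletions l) : b.wordProd p.2 = b.wordProd l * weylGroup.ofIdx P p.1 := by
  induction l generalizing p with
  | nil => simp [deletions] at hp
  | cons s l ih =>
    simp only [deletions, List.mem_cons, List.mem_map] at hp
    rcases hp with rfl | ⟨q, hq, rfl⟩
    · simp [P.ofIdx_weyl_smul, ← mul_assoc, P.ofIdx_mul_self]
    · simp [ih hq, mul_assoc]

variable [Fintype ι] [P.IsCrystallographic] [P.IsReduced]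

lemma length_inv_le (w : P.weylGroup) : b.length w⁻¹ ≤ b.length w := by
  obtain ⟨l, rfl, hl⟩ := b.exists_reducedWord w
  rw [← wordProd_reverse, ← hl]
  simpa using b.length_wordProd_le l.reverse

lemma length_inv (w : P.weylGroup) : b.length w⁻¹ = b.length w :=
  (b.length_inv_le w).antisymm (by simpa using b.length_inv_le w⁻¹)

lemma length_eq_zero {w : P.weylGroup} (h : b.length w = 0) : w = 1 := by
  obtain ⟨l, rfl, hl⟩ := b.exists_reducedWord w
  rw [h, List.length_eq_zero_iff] at hl
  simp [hl]

omit [Fintype ι] [P.IsCrystallographic] [P.IsReduced] in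
lemma length_one : b.length (1 : P.weylGroup) = 0 :=
  Nat.le_zero.1 (b.length_wordProd_le [])

/-- A simple reflection permutes the positive roots other than its own; negative roots follow by
negation. -/
lemma rootSign_reflectionPerm {s : ι} (hs : s ∈ b.support) {j : ι} (h1 : j ≠ s)
    (h2 : j ≠ P.reflectionPerm s s) : b.rootSign (P.reflectionPerm s j) = b.rootSign j := by
  have key : ∀ j, j ≠ s → b.rootSign j = 1 → b.rootSign (P.reflectionPerm s j) = 1 :=
    fun j h1 hj => b.rootSign_eq_one_iff.2 ((b.rootSign_eq_one_iff.1 hj).reflectionPerm hs h1)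
  rcases b.rootSign_eq j with hj | hj
  · rw [key j h1 hj, hj]
  · have h3 := key (P.reflectionPerm j j) (fun h => h2 (P.root.injective (by
      rw [root_reflectionPerm_self, ← h, root_reflectionPerm_self, neg_neg]))) (by rw [rootSign_neg, hj, neg_neg])
    have h4 := P.weyl_smul_reflectionPerm_self (weylGroup.ofIdx P s) j
    simp only [ofIdx_smul_index] at h4
    rw [h4, rootSign_neg] at h3
    omega

lemma sum_rootSign_sub_reflectionPerm {M : Type*} [AddCommGroup M] {s : ι} (hs : s ∈ b.support)
    (H : ι → M) (hH : ∀ i, H (P.reflectionPerm i i) = -H i) :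
    ∑ j, (b.rootSign j - b.rootSign (P.reflectionPerm s j)) • H j = (4 : ℤ) • H s := by
  have hne : s ≠ P.reflectionPerm s s := fun h => by
    have := b.rootSign_neg s
    rw [← h, b.rootSign_of_mem hs] at this
    omega
  classical
  rw [Finset.sum_eq_add s (P.reflectionPerm s s) hne]
  · rw [hH, P.reflectionPerm_self, rootSign_neg, b.rootSign_of_mem hs]
    module
  · intro j _ hj
    rw [b.rootSign_reflectionPerm hs hj.1 hj.2, sub_self, zero_smul]
  · simp
  · simp

/-- The right side depends only on the product of the word, although the left side is read off the
letters. Prepending s changes the signs of w • i only where w • i = ±α_s; these two roots contribute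
2 G each since G is odd, hence the factor 4. -/
lemma sum_deletions {M : Type*} [AddCommGroup M] (G : ι → M)
    (hG : ∀ i, G (P.reflectionPerm i i) = -G i) (l : List b.support) :
    (4 : ℤ) • ((b.deletions l).map fun p => G p.1).sum =
      ∑ i, (b.rootSign i - b.rootSign (b.wordProd l • i)) • G i := by
  induction l with
  | nil => simp [deletions]
  | cons s l ih =>
    have h1 := b.sum_rootSign_sub_reflectionPerm s.2 (fun j => G ((b.wordProd l)⁻¹ • j))
      (fun i => by rw [weyl_smul_reflectionPerm_self, hG])
    rw [← Equiv.sum_comp (MulAction.toPerm (b.wordProd l))] at h1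
    simp only [MulAction.toPerm_apply, inv_smul_smul] at h1
    simp only [deletions, List.map_cons, List.sum_cons, List.map_map, Function.comp_def, smul_add,
      ih, ← h1, ← Finset.sum_add_distrib, wordProd_cons, mul_smul, ofIdx_smul_index]
    refine Finset.sum_congr rfl fun i _ => ?_
    rw [← add_smul]
    congr 1
    ring

/-- Strong exchange: as the letters are applied one by one, the root turns negative at some letter,
and there it must equal the simple root of that letter. -/
lemma exists_mem_deletions {l : List b.support} {i : ι} (hi : b.rootSign i = 1)
    (hli : b.rootSign (b.wordProd l • i) = -1) : ∃ p ∈ b.deletions l, p.1 = i := by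
  induction l with
  | nil => simp [hi] at hli
  | cons s l ih =>
    rcases b.rootSign_eq (b.wordProd l • i) with h | h
    · refine ⟨_, List.mem_cons_self, ?_⟩
      rw [inv_smul_eq_iff]
      by_contra hne
      rw [wordProd_cons, mul_smul, ofIdx_smul_index, b.rootSign_reflectionPerm s.2 (Ne.symm hne),
        h] at hli
      · omega
      · intro h'
        rw [h', rootSign_neg, b.rootSign_of_mem s.2] at h
        omega
    · obtain ⟨p, hp, rfl⟩ := ih h
      exact ⟨(p.1, s :: p.2), List.mem_cons_of_mem _ (List.mem_map_of_mem hp), rfl⟩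

/-- If the root of the first letter s were negative, strong exchange for the reversed tail would
express s times the tail by a word with two letters fewer than the reduced word `s :: l`. -/
lemma rootSign_of_mem_deletions {l : List b.support} (hl : b.length (b.wordProd l) = l.length)
    {p : ι × List b.support} (hp : p ∈ b.deletions l) : b.rootSign p.1 = 1 := by
  induction l generalizing p with
  | nil => simp [deletions] at hp
  | cons s l ih =>
    simp only [deletions, List.mem_cons, List.mem_map] at hp
    rcases hp with rfl | ⟨q, hq, rfl⟩
    · refine (b.rootSign_eq _).resolve_right fun h => ?_
      rw [← wordProd_reverse] at h
      obtain ⟨q, hq, hqs⟩ := b.exists_mem_deletions (b.rootSign_of_mem s.2) h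
      have h1 := b.wordProd_of_mem_deletions hq
      have h2 := b.length_of_mem_deletions hq
      have h3 := b.length_wordProd_le q.2.reverse
      rw [wordProd_reverse, h1, hqs, wordProd_reverse, mul_inv_rev, inv_inv, P.ofIdx_inv,
        ← wordProd_cons, hl] at h3
      simp at h2 h3
      omega
    · refine ih (p := q) ((b.length_wordProd_le l).antisymm ?_) hq
      obtain ⟨l', h1, h2⟩ := b.exists_reducedWord (b.wordProd l)
      have h3 := b.length_wordProd_le (s :: l')
      rw [wordProd_cons, h1, ← wordProd_cons, hl] at h3
      simp at h3
      omega

/-- The length counts inversions: each positive root made negative contributes 2, and so does its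
negative. -/
lemma four_mul_length (w : P.weylGroup) :
    4 * (b.length w : ℤ) = ∑ i, (1 - b.rootSign i * b.rootSign (w • i)) := by
  obtain ⟨l, rfl, hl⟩ := b.exists_reducedWord w
  have h := b.sum_deletions b.rootSign b.rootSign_neg l
  rw [List.map_congr_left (g := fun _ => (1 : ℤ))
    fun p hp => b.rootSign_of_mem_deletions hl.symm hp] at h
  simp only [List.map_const', List.sum_replicate, length_deletions, smul_eq_mul, nsmul_eq_mul,
    mul_one] at h
  rw [← hl, h]
  refine Finset.sum_congr rfl fun i _ => ?_
  rw [sub_mul, rootSign_mul_self, mul_comm]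

/-- By `sum_deletions` the length is a sum of signs ±1 with one term per letter. -/
lemma length_wordProd_mod_two (l : List b.support) :
    b.length (b.wordProd l) % 2 = l.length % 2 := by
  have h := b.sum_deletions b.rootSign b.rootSign_neg l
  have h1 := b.four_mul_length (b.wordProd l)
  have h2 : ∑ i, (1 - b.rootSign i * b.rootSign (b.wordProd l • i)) =
      ∑ i, (b.rootSign i - b.rootSign (b.wordProd l • i)) • b.rootSign i :=
    Finset.sum_congr rfl fun i _ => by rw [smul_eq_mul, sub_mul, rootSign_mul_self, mul_comm]
  have h3 : ∀ L : List (ι × List b.support),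
      ((L.map fun p => b.rootSign p.1).sum - L.length) % 2 = 0 := by
    intro L
    induction L with
    | nil => simp
    | cons p L ih =>
      have := b.rootSign_eq p.1
      simp only [List.map_cons, List.sum_cons, List.length_cons]
      push_cast
      omega
  have h4 := h3 (b.deletions l)
  rw [length_deletions] at h4
  rw [h2, ← h, smul_eq_mul] at h1
  omega

/-! ### The longest element. -/

section Longest

variable {w₀ : P.weylGroup} (hw₀ : ∀ w, b.length w ≤ b.length w₀)

include hw₀

/-- If w₀ kept a simple root α_s positive, w₀s would be longer than w₀. Negativity then passes from
simple roots to all positive roots by adding simple roots. -/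
lemma rootSign_longest_smul (i : ι) : b.rootSign (w₀ • i) = -b.rootSign i := by
  have hs : ∀ s ∈ b.support, b.rootSign (w₀ • s) = -1 := by
    intro s hs
    refine (b.rootSign_eq _).resolve_left fun h => ?_
    have h1 := b.four_mul_length w₀
    have h2 := b.four_mul_length (w₀ * weylGroup.ofIdx P s)
    have h3 := b.sum_rootSign_sub_reflectionPerm hs (fun i => b.rootSign (w₀ • i))
      (fun i => by rw [weyl_smul_reflectionPerm_self, rootSign_neg])
    -- Reindexing by s puts the factor sign(w₀ • i) in both length sums, so that `h3` gives ℓ(w₀s) -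
    -- ℓ(w₀) = 1.
    rw [← Equiv.sum_comp (MulAction.toPerm (weylGroup.ofIdx P s))] at h2
    simp only [MulAction.toPerm_apply, ← mul_smul, mul_assoc, P.ofIdx_mul_self, mul_one] at h2
    simp only [ofIdx_smul_index] at h2
    simp only [smul_eq_mul, sub_mul, Finset.sum_sub_distrib, h] at h1 h2 h3
    have := hw₀ (w₀ * weylGroup.ofIdx P s)
    omega
  have hpos : ∀ i, b.IsPos i → b.height (w₀ • i) < 0 := by
    intro i hi
    refine hi.induction_on_add (p := fun i => b.height (w₀ • i) < 0) ?_ ?_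
    · intro s h
      have h1 := hs s h
      have h2 := b.height_ne_zero (w₀ • s)
      unfold rootSign at h1
      split_ifs at h1
      · omega
    · intro i j k hk hi hj
      have h1 := hs j hj
      have h2 : P.root (w₀ • k) = P.root (w₀ • i) + P.root (w₀ • j) := by
        rw [root_weyl_smul, root_weyl_smul, root_weyl_smul, hk]
        exact LinearMap.map_add (P.weylGroupRootRep w₀) _ _
      rw [b.height_add h2]
      unfold rootSign at h1
      split_ifs at h1
      · omega
  have key : ∀ i, b.rootSign i = 1 → b.rootSign (w₀ • i) = -1 := fun i hi => by
    have := hpos i (b.rootSign_eq_one_iff.1 hi)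
    rw [rootSign, if_neg (by omega)]
  rcases b.rootSign_eq i with h | h
  · rw [key i h, h]
  · have h1 := key (P.reflectionPerm i i) (by rw [rootSign_neg, h, neg_neg])
    rw [weyl_smul_reflectionPerm_self, rootSign_neg] at h1
    omega

/-- Since w₀ reverses every sign, w⁻¹w₀ has inversions exactly where w⁻¹, after reindexing by w₀,
has none. -/
lemma length_inv_mul_longest (w : P.weylGroup) :
    b.length (w⁻¹ * w₀) + b.length w = b.length w₀ := by
  have h1 := b.four_mul_length (w⁻¹ * w₀)
  have h2 := b.four_mul_length w⁻¹
  have h3 := b.four_mul_length w₀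
  rw [length_inv] at h2
  rw [← Equiv.sum_comp (MulAction.toPerm w₀)] at h2
  simp only [MulAction.toPerm_apply, b.rootSign_longest_smul hw₀, mul_smul] at h1 h2 h3
  have h4 : ∀ i, b.rootSign i * -b.rootSign i = -1 := fun i => by
    rw [mul_neg, rootSign_mul_self]
  simp only [h4, neg_mul, sub_neg_eq_add, Finset.sum_sub_distrib, Finset.sum_add_distrib]
    at h1 h2 h3
  omega

lemma eq_longest {w : P.weylGroup} (h : b.length w = b.length w₀) : w = w₀ := by
  have := b.length_inv_mul_longest hw₀ w
  exact inv_mul_eq_one.1 (b.length_eq_zero (w := w⁻¹ * w₀) (by omega))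

open Classical in
lemma card_isPos : (Finset.univ.filter fun i => b.IsPos i).card = b.length w₀ := by
  have h1 := b.four_mul_length w₀
  have h4 : ∀ i, b.rootSign i * -b.rootSign i = -1 := fun i => by
    rw [mul_neg, rootSign_mul_self]
  simp only [b.rootSign_longest_smul hw₀, h4] at h1
  have h2 : ∑ i, b.rootSign i = 0 := by
    have h := Equiv.sum_comp (MulAction.toPerm w₀) b.rootSign
    simp only [MulAction.toPerm_apply, b.rootSign_longest_smul hw₀, Finset.sum_neg_distrib] at h
    omega
  have h3 : ∑ i, (1 + b.rootSign i) =
      2 * ((Finset.univ.filter fun i => b.IsPos i).card : ℤ) := by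
    rw [Finset.card_filter]
    push_cast
    rw [Finset.mul_sum]
    refine Finset.sum_congr rfl fun i _ => ?_
    have := b.rootSign_eq i
    have := b.rootSign_eq_one_iff (i := i)
    split_ifs <;> grind
  rw [Finset.sum_add_distrib, h2] at h3
  simp only [Finset.sum_const, nsmul_eq_mul] at h1 h3
  omega

end Longest

end Base

end RootPairing

/-! ### The symmetric algebra and its homogeneous components. -/

namespace RootPairing

variable {ι V V' : Type*} [AddCommGroup V] [Module ℂ V] [AddCommGroup V'] [Module ℂ V']

local notation "S" => SymmetricAlgebra ℂ V
local notation "ιS" => SymmetricAlgebra.ι ℂ V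

lemma symmetricAlgebra_ι_ne_zero {x : V} (hx : x ≠ 0) : ιS x ≠ 0 := by
  intro h
  apply hx
  rw [← Module.forall_dual_apply_eq_zero_iff ℂ]
  intro f
  rw [← SymmetricAlgebra.lift_ι_apply f, h, map_zero]

lemma symmetricAlgebra_submodule_eq_top (N : Submodule ℂ S) (h1 : 1 ∈ N)
    (hN : ∀ x, ∀ f ∈ N, ιS x * f ∈ N) : N = ⊤ := by
  have key : ∀ a : S, ∀ f ∈ N, a * f ∈ N := by
    intro a
    induction a using SymmetricAlgebra.induction with
    | algebraMap r => intro f hf; rw [← Algebra.smul_def]; exact N.smul_mem r hf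
    | ι x => exact hN x
    | mul a b ha hb => intro f hf; rw [mul_assoc]; exact ha _ (hb _ hf)
    | add a b ha hb => intro f hf; rw [add_mul]; exact N.add_mem (ha _ hf) (hb _ hf)
  exact (Submodule.eq_top_iff').2 fun a => by simpa using key a 1 h1

section SymPower

lemma mem_symPower_zero {f : S} (hf : f ∈ symPower V 0) :
    f = algebraMap ℂ S (SymmetricAlgebra.algebraMapInv f) := by
  rw [symPower, pow_zero] at hf
  obtain ⟨r, rfl⟩ := Submodule.mem_one.1 hf
  rw [SymmetricAlgebra.algebraMap_leftInverse]

lemma symPower_succ (j : ℕ) :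
    symPower V (j + 1) = LinearMap.range ιS * symPower V j := pow_succ' _ _

lemma symPower_add (i j : ℕ) : symPower V (i + j) = symPower V i * symPower V j := pow_add _ _ _

lemma one_mem_symPower_zero : (1 : S) ∈ symPower V 0 := by
  rw [symPower, pow_zero]; exact Submodule.one_le.1 le_rfl

lemma mul_mem_symPower {i j : ℕ} {f g : S} (hf : f ∈ symPower V i) (hg : g ∈ symPower V j) :
    f * g ∈ symPower V (i + j) := by
  rw [symPower_add]; exact Submodule.mul_mem_mul hf hg

lemma ι_mem_symPower_one (x : V) : ιS x ∈ symPower V 1 := by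
  rw [symPower, pow_one]; exact ⟨x, rfl⟩

lemma prod_ι_mem_symPower {κ : Type*} (t : Finset κ) (v : κ → V) :
    ∏ i ∈ t, ιS (v i) ∈ symPower V t.card := by
  classical
  induction t using Finset.induction_on with
  | empty => exact one_mem_symPower_zero
  | insert a t ha ih =>
    rw [Finset.prod_insert ha, Finset.card_insert_of_notMem ha, add_comm]
    exact mul_mem_symPower (ι_mem_symPower_one _) ih

lemma algebraMapInv_of_mem_symPower {j : ℕ} (hj : j ≠ 0) {f : S} (hf : f ∈ symPower V j) :
    SymmetricAlgebra.algebraMapInv f = 0 := by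
  obtain ⟨j, rfl⟩ := Nat.exists_eq_succ_of_ne_zero hj
  rw [Nat.succ_eq_add_one, symPower_succ] at hf
  induction hf using Submodule.mul_induction_on' with
  | mem_mul_mem m hm n hn =>
    obtain ⟨x, rfl⟩ := hm
    rw [map_mul, SymmetricAlgebra.algebraMapInv_ι, zero_mul]
  | add x _ y _ hx hy => rw [map_add, hx, hy, add_zero]

lemma iSup_symPower : ⨆ j, symPower V j = ⊤ := by
  refine symmetricAlgebra_submodule_eq_top _
    (Submodule.mem_iSup_of_mem 0 one_mem_symPower_zero) fun x f hf => ?_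
  induction hf using Submodule.iSup_induction' with
  | mem j f hf =>
    exact Submodule.mem_iSup_of_mem (1 + j) (mul_mem_symPower (ι_mem_symPower_one x) hf)
  | zero => simp
  | add f g _ _ hf hg => rw [mul_add]; exact add_mem hf hg

lemma exists_sum_symPower (f : S) :
    ∃ (g : ℕ → S) (n : ℕ), (∀ j, g j ∈ symPower V j) ∧ f = ∑ j ∈ Finset.range n, g j := by
  have hf : f ∈ ⨆ j, symPower V j := by rw [iSup_symPower]; trivial
  rw [Submodule.mem_iSup_iff_exists_finsupp] at hf
  obtain ⟨g, hg, rfl⟩ := hf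
  refine ⟨g, g.support.sup id + 1, hg, ?_⟩
  refine Finset.sum_subset (fun j hj => ?_) fun j _ hj => by simpa using hj
  exact Finset.mem_range.2 (Nat.lt_succ_of_le (Finset.le_sup (f := id) hj))

end SymPower

/-! ### The Weyl group action on S(V) and single Demazure operators. -/

section Weyl

variable (P : RootPairing ι ℂ V V')

@[simp] lemma weylSym_ι (w : P.weylGroup) (x : V) : P.weylSym w (ιS x) = ιS (w • x) :=
  SymmetricAlgebra.lift_ι_apply _ _

lemma weylSym_one (f : S) : P.weylSym 1 f = f := by
  have : P.weylSym 1 = AlgHom.id ℂ S := by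
    ext x
    simp
  rw [this]; rfl

lemma weylSym_mul (w w' : P.weylGroup) (f : S) :
    P.weylSym (w * w') f = P.weylSym w (P.weylSym w' f) := by
  have : P.weylSym (w * w') = (P.weylSym w).comp (P.weylSym w') := by
    ext x
    simp [mul_smul]
  rw [this]; rfl

lemma weylSym_mem_symPower (w : P.weylGroup) {j : ℕ} {f : S} (hf : f ∈ symPower V j) :
    P.weylSym w f ∈ symPower V j := by
  have h : (symPower V j).map (P.weylSym w).toLinearMap ≤ symPower V j := by
    rw [symPower, Submodule.map_pow]
    refine pow_le_pow_left' ?_ j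
    rintro _ ⟨_, ⟨x, rfl⟩, rfl⟩
    exact ⟨w • x, (P.weylSym_ι w x).symm⟩
  exact h ⟨f, hf, rfl⟩

lemma ι_root_ne_zero (i : ι) : ιS (P.root i) ≠ 0 := symmetricAlgebra_ι_ne_zero (P.ne_zero i)

lemma ι_mul_demazureRoot (i : ι) (f : S) :
    ιS (P.root i) * P.demazureRoot i f = f - P.weylSym (weylGroup.ofIdx P i) f :=
  (P.dvd_sub_weylSym i f).choose_spec.symm

/-- S(V) is a domain, so the quotient picked by choice is the only one; all properties of Δ are
derived through this. -/
lemma demazureRoot_eq {i : ι} {f g : S}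
    (h : ιS (P.root i) * g = f - P.weylSym (weylGroup.ofIdx P i) f) : P.demazureRoot i f = g :=
  mul_left_cancel₀ (P.ι_root_ne_zero i) ((P.ι_mul_demazureRoot i f).trans h.symm)

/-- The Demazure operator of a root as a linear map. -/
noncomputable def demazureEnd (i : ι) : Module.End ℂ S where
  toFun := P.demazureRoot i
  map_add' f g := P.demazureRoot_eq (by
    rw [mul_add, ι_mul_demazureRoot, ι_mul_demazureRoot, map_add]; ring)
  map_smul' r f := P.demazureRoot_eq (by
    rw [RingHom.id_apply, mul_smul_comm, ι_mul_demazureRoot, map_smul, smul_sub])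

lemma ι_mul_demazureEnd (i : ι) (f : S) :
    ιS (P.root i) * P.demazureEnd i f = f - P.weylSym (weylGroup.ofIdx P i) f :=
  P.ι_mul_demazureRoot i f

lemma demazureEnd_eq {i : ι} {f g : S}
    (h : ιS (P.root i) * g = f - P.weylSym (weylGroup.ofIdx P i) f) : P.demazureEnd i f = g :=
  P.demazureRoot_eq h

lemma demazureEnd_mul (i : ι) (f g : S) :
    P.demazureEnd i (f * g) =
      P.demazureEnd i f * g + P.weylSym (weylGroup.ofIdx P i) f * P.demazureEnd i g := by
  refine P.demazureEnd_eq ?_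
  rw [mul_add, ← mul_assoc, mul_left_comm, ι_mul_demazureEnd, ι_mul_demazureEnd, map_mul]
  ring

lemma demazureEnd_of_invariant {i : ι} {f : S} (h : P.weylSym (weylGroup.ofIdx P i) f = f) :
    P.demazureEnd i f = 0 :=
  P.demazureEnd_eq (by rw [h, mul_zero, sub_self])

lemma demazureEnd_mul_of_invariant {i : ι} {f : S}
    (h : P.weylSym (weylGroup.ofIdx P i) f = f) (g : S) :
    P.demazureEnd i (f * g) = f * P.demazureEnd i g := by
  rw [demazureEnd_mul, P.demazureEnd_of_invariant h, h, zero_mul, zero_add]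

lemma weylSym_demazureEnd (i : ι) (f : S) :
    P.weylSym (weylGroup.ofIdx P i) (P.demazureEnd i f) = P.demazureEnd i f := by
  symm
  refine P.demazureEnd_eq ?_
  have h := congrArg (P.weylSym (weylGroup.ofIdx P i)) (P.ι_mul_demazureEnd i f)
  rw [map_mul, weylSym_ι, map_sub, ← weylSym_mul, ofIdx_mul_self, weylSym_one, ofIdx_smul_vec,
    reflection_apply_self, map_neg] at h
  linear_combination -h

lemma demazureEnd_demazureEnd (i : ι) (f : S) : P.demazureEnd i (P.demazureEnd i f) = 0 :=
  P.demazureEnd_of_invariant (P.weylSym_demazureEnd i f)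

lemma demazureEnd_algebraMap (i : ι) (r : ℂ) : P.demazureEnd i (algebraMap ℂ S r) = 0 :=
  P.demazureEnd_of_invariant (by simp)

lemma demazureEnd_ι (i : ι) (x : V) :
    P.demazureEnd i (ιS x) = algebraMap ℂ S (P.coroot' i x) := by
  refine P.demazureEnd_eq ?_
  rw [weylSym_ι, ofIdx_smul_vec, P.reflection_apply, map_sub, map_smul, sub_sub_cancel,
    Algebra.smul_def, mul_comm]

lemma demazureEnd_ι_mul (i : ι) (x : V) (f : S) :
    P.demazureEnd i (ιS x * f) =
      ιS (weylGroup.ofIdx P i • x) * P.demazureEnd i f + P.coroot' i x • f := by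
  rw [demazureEnd_mul, demazureEnd_ι, weylSym_ι, Algebra.smul_def, add_comm]

lemma demazureEnd_mem_symPower (i : ι) {j : ℕ} {f : S} (hf : f ∈ symPower V (j + 1)) :
    P.demazureEnd i f ∈ symPower V j := by
  induction j generalizing f with
  | zero =>
    rw [zero_add, symPower, pow_one] at hf
    obtain ⟨x, rfl⟩ := hf
    rw [demazureEnd_ι, symPower, pow_zero]
    exact Submodule.mem_one.2 ⟨_, rfl⟩
  | succ j ih =>
    rw [symPower_succ] at hf
    induction hf using Submodule.mul_induction_on' with
    | mem_mul_mem m hm n hn =>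
      obtain ⟨x, rfl⟩ := hm
      rw [demazureEnd_ι_mul]
      refine add_mem ?_ (Submodule.smul_mem _ _ hn)
      rw [add_comm]
      exact mul_mem_symPower (ι_mem_symPower_one _) (ih hn)
    | add x _ y _ hx hy => rw [map_add]; exact add_mem hx hy

lemma weylSym_mem_coinvariantIdeal (w : P.weylGroup) {f : S} (hf : f ∈ P.coinvariantIdeal) :
    P.weylSym w f ∈ P.coinvariantIdeal := by
  have h : P.coinvariantIdeal ≤ P.coinvariantIdeal.comap (P.weylSym w) :=
    Ideal.span_le.2 fun g hg => by
      change P.weylSym w g ∈ P.coinvariantIdeal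
      rw [hg.choose_spec.2.2 w]
      exact Ideal.subset_span hg
  exact h hf

end Weyl

/-! ### Demazure operators along words, and I_W as their common kernel at 0. -/

namespace Base

variable {P : RootPairing ι ℂ V V'} (b : P.Base)

/-- The composite of the Demazure operators along a word, as a linear map. -/
noncomputable def wordEnd (l : List b.support) : Module.End ℂ S :=
  (l.map fun s => P.demazureEnd (s : ι)).prod

@[simp] lemma wordEnd_nil : b.wordEnd [] = 1 := rfl

@[simp] lemma wordEnd_cons (s : b.support) (l : List b.support) :
    b.wordEnd (s :: l) = P.demazureEnd (s : ι) * b.wordEnd l := by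
  simp [wordEnd]

lemma wordEnd_append (l l' : List b.support) :
    b.wordEnd (l ++ l') = b.wordEnd l * b.wordEnd l' := by
  simp [wordEnd]

lemma demazureWord_eq (l : List b.support) (f : S) : b.demazureWord l f = b.wordEnd l f := by
  induction l with
  | nil => rfl
  | cons s l ih =>
    rw [wordEnd_cons, Module.End.mul_apply, ← ih]
    rfl

lemma wordEnd_mem_symPower (l : List b.support) {j : ℕ} {f : S}
    (hf : f ∈ symPower V (l.length + j)) : b.wordEnd l f ∈ symPower V j := by
  induction l generalizing j with
  | nil => simpa using hf
  | cons s l ih =>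
    rw [wordEnd_cons, Module.End.mul_apply]
    refine P.demazureEnd_mem_symPower _ (ih ?_)
    rwa [List.length_cons, add_assoc, add_comm 1 j] at hf

lemma wordEnd_eq_zero_of_lt (l : List b.support) {j : ℕ} (hj : j < l.length) {f : S}
    (hf : f ∈ symPower V j) : b.wordEnd l f = 0 := by
  induction l generalizing j with
  | nil => simp at hj
  | cons s l ih =>
    rw [wordEnd_cons, Module.End.mul_apply]
    rcases Nat.lt_succ_iff_lt_or_eq.1 hj with h | rfl
    · rw [ih h hf, map_zero]
    · have := b.wordEnd_mem_symPower l (j := 0) hf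
      rw [mem_symPower_zero this, demazureEnd_algebraMap]

/-- The linear form `f ↦ (Δ_{s₁} ⋯ Δ_{sₖ} f)(0)` of a word `s₁ ⋯ sₖ`. -/
noncomputable def wordForm (l : List b.support) : S →ₗ[ℂ] ℂ :=
  SymmetricAlgebra.algebraMapInv.toLinearMap ∘ₗ b.wordEnd l

lemma wordForm_apply (l : List b.support) (f : S) :
    b.wordForm l f = SymmetricAlgebra.algebraMapInv (b.wordEnd l f) := rfl

lemma wordForm_of_mem_symPower {l : List b.support} {j : ℕ} (hj : j ≠ l.length) {f : S}
    (hf : f ∈ symPower V j) : b.wordForm l f = 0 := by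
  rw [wordForm_apply]
  rcases lt_or_gt_of_ne hj with h | h
  · rw [b.wordEnd_eq_zero_of_lt l h hf, map_zero]
  · obtain ⟨k, rfl⟩ := Nat.exists_eq_add_of_lt h
    rw [add_assoc] at hf
    exact algebraMapInv_of_mem_symPower (Nat.succ_ne_zero k) (b.wordEnd_mem_symPower l hf)

/-- Iterated twisted Leibniz rule: each letter either reflects x or is spent on x, producing a
scalar and disappearing from the word. -/
lemma wordEnd_ι_mul (l : List b.support) (x : V) (f : S) :
    b.wordEnd l (ιS x * f) = ιS (b.wordProd l • x) * b.wordEnd l f +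
      ((b.deletions l).map fun p => P.coroot' p.1 x • b.wordEnd p.2 f).sum := by
  induction l with
  | nil => simp [deletions]
  | cons s l ih =>
    have h1 : P.coroot' s (b.wordProd l • x) = P.coroot' ((b.wordProd l)⁻¹ • (s : ι)) x := by
      rw [← P.coroot'_weyl_smul (b.wordProd l) _ x, smul_inv_smul]
    simp only [deletions, wordEnd_cons, Module.End.mul_apply, ih, map_add,
      P.demazureEnd_ι_mul, wordProd_cons, mul_smul, h1, List.map_cons, List.sum_cons, List.map_map,
      Function.comp_def, map_list_sum, map_smul, add_assoc]

lemma wordEnd_mul_of_invariant (l : List b.support) {f : S} (hf : ∀ w, P.weylSym w f = f)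
    (g : S) : b.wordEnd l (f * g) = f * b.wordEnd l g := by
  induction l with
  | nil => rfl
  | cons s l ih =>
    rw [wordEnd_cons, Module.End.mul_apply, ih, P.demazureEnd_mul_of_invariant (hf _)]
    rfl

lemma wordForm_of_mem_coinvariantIdeal (l : List b.support) {f : S}
    (hf : f ∈ P.coinvariantIdeal) : b.wordForm l f = 0 := by
  -- The arbitrary multiplier makes the claim stable under the ideal's scalar action; on generators,
  -- the invariant passes through every Δ and vanishes at 0.
  suffices h : ∀ a : S, b.wordForm l (a * f) = 0 by simpa using h 1
  induction hf using Submodule.span_induction with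
  | mem f h =>
    obtain ⟨j, hj, hf, hw⟩ := h
    intro a
    rw [mul_comm, wordForm_apply, b.wordEnd_mul_of_invariant l hw, map_mul,
      algebraMapInv_of_mem_symPower (by omega) hf, zero_mul]
  | zero => simp
  | add x y _ _ hx hy => intro a; rw [mul_add, map_add, hx, hy, add_zero]
  | smul r x _ hx => intro a; rw [smul_eq_mul, ← mul_assoc, hx]

variable [Fintype ι] [P.IsCrystallographic] [P.IsReduced]

/-- Both operators kill 1, and their commutators with x ∈ V agree: these are sums over deletions,
which the inductive hypothesis and `sum_deletions` express through the product alone. -/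
theorem wordEnd_congr {l l' : List b.support} (hlen : l.length = l'.length)
    (hprod : b.wordProd l = b.wordProd l') : b.wordEnd l = b.wordEnd l' := by
  classical
  obtain ⟨k, hk⟩ : ∃ k, l.length = k := ⟨_, rfl⟩
  induction k generalizing l l' with
  | zero =>
    rw [List.length_eq_zero_iff.1 hk, List.length_eq_zero_iff.1 (hlen.symm.trans hk)]
  | succ k ih =>
    -- The operator attached to a group element by words of length k. The default 0 is harmless:
    -- `sum_deletions` holds for every odd function, and its left side only meets products of words
    -- of length k.
    let F : P.weylGroup → Module.End ℂ S := fun u =>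
      if h : ∃ m : List b.support, m.length = k ∧ b.wordProd m = u then b.wordEnd h.choose else 0
    have hF : ∀ m : List b.support, m.length = k → F (b.wordProd m) = b.wordEnd m := by
      intro m hm
      have h : ∃ m' : List b.support, m'.length = k ∧ b.wordProd m' = b.wordProd m := ⟨m, hm, rfl⟩
      simp only [F, dif_pos h]
      exact ih (h.choose_spec.1.trans hm.symm) h.choose_spec.2 h.choose_spec.1
    have key : ∀ m : List b.support, m.length = k + 1 → ∀ x f,
        (4 : ℤ) • ((b.deletions m).map fun p => P.coroot' p.1 x • b.wordEnd p.2 f).sum =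
          ∑ i, (b.rootSign i - b.rootSign (b.wordProd m • i)) •
            (P.coroot' i x • F (b.wordProd m * weylGroup.ofIdx P i) f) := by
      intro m hm x f
      rw [← b.sum_deletions (fun i => P.coroot' i x • F (b.wordProd m * weylGroup.ofIdx P i) f)]
      · congr 2
        refine List.map_congr_left fun p hp => ?_
        have := b.length_of_mem_deletions hp
        rw [← b.wordProd_of_mem_deletions hp, hF _ (by omega)]
      · intro i
        rw [P.coroot'_reflectionPerm_self, P.ofIdx_reflectionPerm_self, neg_smul]
    rw [← LinearMap.eqLocus_eq_top]
    refine symmetricAlgebra_submodule_eq_top _ ?_ fun x f hf => ?_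
    · rw [LinearMap.mem_eqLocus, b.wordEnd_eq_zero_of_lt l (by omega) one_mem_symPower_zero,
        b.wordEnd_eq_zero_of_lt l' (by omega) one_mem_symPower_zero]
    · rw [LinearMap.mem_eqLocus] at hf ⊢
      rw [wordEnd_ι_mul, wordEnd_ι_mul, hf, hprod]
      congr 1
      have h1 := key l hk x f
      have h2 := key l' (by omega) x f
      rw [hprod, ← h2, ← sub_eq_zero, ← smul_sub, ← Int.cast_smul_eq_zsmul ℂ] at h1
      exact sub_eq_zero.1 ((smul_eq_zero.1 h1).resolve_left (by norm_num))

/-- By parity, the word may be replaced by a reduced one padded with an even number of copies of a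
letter s, and Δ_s² = 0. -/
lemma wordEnd_eq_zero {l : List b.support} (hl : b.length (b.wordProd l) < l.length) :
    b.wordEnd l = 0 := by
  obtain ⟨l', h1, h2⟩ := b.exists_reducedWord (b.wordProd l)
  have h3 := b.length_wordProd_mod_two l
  obtain ⟨m, hm⟩ : ∃ m, l.length = l'.length + 2 * (m + 1) :=
    ⟨(l.length - l'.length) / 2 - 1, by omega⟩
  obtain ⟨s, -⟩ := List.exists_mem_of_length_pos (l := l) (by omega)
  have hs : ∀ n, b.wordProd (List.replicate (2 * n) s) = 1 := by
    intro n
    induction n with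
    | zero => rfl
    | succ n ih =>
      rw [Nat.mul_succ, List.replicate_succ, List.replicate_succ, wordProd_cons, wordProd_cons,
        ih, mul_one, P.ofIdx_mul_self]
  rw [b.wordEnd_congr (l' := l' ++ List.replicate (2 * (m + 1)) s) (by simp [hm])
    (by rw [wordProd_append, hs, mul_one, h1]), wordEnd_append, Nat.mul_succ, List.replicate_succ,
    List.replicate_succ, wordEnd_cons, wordEnd_cons, ← mul_assoc (P.demazureEnd _)]
  have : P.demazureEnd (s : ι) * P.demazureEnd (s : ι) = 0 :=
    LinearMap.ext (P.demazureEnd_demazureEnd s)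
  rw [this, zero_mul, mul_zero]

/-- By induction on the degree each Δ_s f lies in I_W, so f ≡ sf and then f ≡ wf for all w.
Averaging, f is congruent to an invariant of positive degree, which lies in I_W. -/
lemma mem_coinvariantIdeal_of_mem_symPower [P.IsRootSystem] {j : ℕ} {f : S}
    (hf : f ∈ symPower V j) (h : ∀ l, b.wordForm l f = 0) : f ∈ P.coinvariantIdeal := by
  induction j generalizing f with
  | zero =>
    have h0 : SymmetricAlgebra.algebraMapInv f = 0 := h []
    rw [mem_symPower_zero hf, h0, map_zero]
    exact zero_mem _
  | succ j ih =>
    have h1 : ∀ s : b.support, f - P.weylSym (weylGroup.ofIdx P (s : ι)) f ∈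
        P.coinvariantIdeal := by
      intro s
      rw [← ι_mul_demazureEnd]
      refine Ideal.mul_mem_left _ _ (ih (P.demazureEnd_mem_symPower _ hf) fun l => ?_)
      have := h (l ++ [s])
      rwa [wordForm_apply, wordEnd_append, wordEnd_cons, wordEnd_nil, mul_one] at this
    have h2 : ∀ w, f - P.weylSym w f ∈ P.coinvariantIdeal := by
      intro w
      obtain ⟨l, rfl⟩ := b.exists_wordProd_eq w
      induction l with
      | nil => simp [weylSym_one]
      | cons s l ihl =>
        rw [wordProd_cons, weylSym_mul]
        have h3 := P.weylSym_mem_coinvariantIdeal (weylGroup.ofIdx P (s : ι)) ihl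
        have h4 := add_mem (h1 s) h3
        rwa [map_sub, sub_add_sub_cancel] at h4
    have := P.finite_weylGroup
    have := Fintype.ofFinite P.weylGroup
    have hsum : ∑ w, P.weylSym w f ∈ P.coinvariantIdeal := by
      refine Ideal.subset_span ⟨j + 1, by omega,
        Submodule.sum_mem _ fun w _ => P.weylSym_mem_symPower w hf, fun w => ?_⟩
      rw [map_sum]
      simp only [← weylSym_mul]
      exact Equiv.sum_comp (Equiv.mulLeft w) fun w => P.weylSym w f
    have hadd := add_mem (Submodule.sum_mem _ fun w (_ : w ∈ Finset.univ) => h2 w) hsum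
    rw [Finset.sum_sub_distrib, sub_add_cancel, Finset.sum_const, ← Nat.cast_smul_eq_nsmul ℂ]
      at hadd
    have hcard : ((Finset.univ : Finset P.weylGroup).card : ℂ) ≠ 0 := by
      rw [Nat.cast_ne_zero, Finset.card_univ]
      exact Fintype.card_ne_zero
    have := (P.coinvariantIdeal.restrictScalars ℂ).smul_mem
      ((Finset.univ : Finset P.weylGroup).card : ℂ)⁻¹ hadd
    rwa [smul_smul, inv_mul_cancel₀ hcard, one_smul] at this

theorem mem_coinvariantIdeal_iff [P.IsRootSystem] {f : S} :
    f ∈ P.coinvariantIdeal ↔ ∀ l, b.wordForm l f = 0 := by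
  refine ⟨fun hf l => b.wordForm_of_mem_coinvariantIdeal l hf, fun h => ?_⟩
  obtain ⟨g, n, hg, rfl⟩ := exists_sum_symPower f
  refine Submodule.sum_mem _ fun j hj => b.mem_coinvariantIdeal_of_mem_symPower (hg j) fun l => ?_
  by_cases hl : j = l.length
  · have h1 := h l
    rwa [map_sum, Finset.sum_eq_single_of_mem j hj fun i _ hi =>
      b.wordForm_of_mem_symPower (hl ▸ hi) (hg i)] at h1
  · exact b.wordForm_of_mem_symPower hl (hg j)

end Base

end RootPairing

/-! ### Alternating elements, and the product of the positive roots modulo I_W. -/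

lemma Finset.prod_dvd_of_prime {κ A : Type*} [CommRing A] [IsDomain A] (t : Finset κ) (p : κ → A)
    (hp : ∀ i ∈ t, Prime (p i)) (hnd : ∀ i ∈ t, ∀ j ∈ t, i ≠ j → ¬ p i ∣ p j) {z : A}
    (hz : ∀ i ∈ t, p i ∣ z) : ∏ i ∈ t, p i ∣ z := by
  classical
  induction t using Finset.induction_on with
  | empty => simp
  | insert a t ha ih =>
    obtain ⟨y, rfl⟩ := ih (fun i hi => hp i (mem_insert_of_mem hi))
      (fun i hi j hj => hnd i (mem_insert_of_mem hi) j (mem_insert_of_mem hj))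
      (fun i hi => hz i (mem_insert_of_mem hi))
    have hpa := hp a (mem_insert_self a t)
    rcases hpa.dvd_or_dvd (hz a (mem_insert_self a t)) with h | h
    · obtain ⟨i, hi, h⟩ := hpa.exists_mem_finset_dvd h
      exact absurd h (hnd a (mem_insert_self a t) i (mem_insert_of_mem hi)
        fun h => ha (h ▸ hi))
    · rw [prod_insert ha, mul_comm]
      exact mul_dvd_mul_left _ h

namespace RootPairing

variable {ι V V' : Type*} [AddCommGroup V] [Module ℂ V] [AddCommGroup V'] [Module ℂ V']

local notation "S" => SymmetricAlgebra ℂ V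
local notation "ιS" => SymmetricAlgebra.ι ℂ V

/-- Extended to a basis of V, x becomes a variable of a polynomial ring. -/
lemma prime_symmetricAlgebra_ι {x : V} (hx : x ≠ 0) : Prime (ιS x) := by
  have hli : LinearIndepOn ℂ id ({x} : Set V) := LinearIndepOn.singleton (v := id) hx
  let B := Module.Basis.extend hli
  have hxB : x ∈ hli.extend (Set.subset_univ _) := hli.subset_extend _ rfl
  have h := SymmetricAlgebra.equivMvPolynomial_ι_apply B ⟨x, hxB⟩
  rw [Module.Basis.extend_apply_self] at h
  rw [← MulEquiv.prime_iff (SymmetricAlgebra.equivMvPolynomial B)]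
  rw [h]
  exact MvPolynomial.X_prime

lemma not_symmetricAlgebra_ι_dvd {x y : V} (h : LinearIndependent ℂ ![x, y]) :
    ¬ ιS x ∣ ιS y := by
  rintro ⟨g, hg⟩
  have hy : y ∉ Submodule.span ℂ {x} := fun hy => by
    obtain ⟨r, rfl⟩ := Submodule.mem_span_singleton.1 hy
    have := LinearIndependent.pair_iff.1 h r (-1) (by simp)
    simp at this
  obtain ⟨f, hf, hfx⟩ := Submodule.exists_le_ker_of_notMem hy
  have h1 : f x = 0 := hfx (Submodule.mem_span_singleton_self x)
  apply hf
  have h2 := congrArg (SymmetricAlgebra.lift f) hg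
  rwa [map_mul, SymmetricAlgebra.lift_ι_apply, SymmetricAlgebra.lift_ι_apply, h1, zero_mul] at h2

namespace Base

variable {P : RootPairing ι ℂ V V'} (b : P.Base)
variable [Fintype ι] [P.IsCrystallographic] [P.IsReduced]

section Alternating

open Classical in
/-- The product of the positive roots. -/
noncomputable def posProd : S := ∏ i ∈ Finset.univ.filter (fun i => b.IsPos i), ιS (P.root i)

open Classical in
-- From 2f = f - sf, every simple root divides f; reflecting, every root does. Distinct positive
-- roots are non-associated primes.
lemma posProd_dvd {f : S} (hf : ∀ s ∈ b.support, P.weylSym (weylGroup.ofIdx P s) f = -f) :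
    b.posProd ∣ f := by
  refine Finset.prod_dvd_of_prime _ _ (fun i _ => prime_symmetricAlgebra_ι (P.ne_zero i)) ?_ ?_
  · intro i hi j hj hij
    refine not_symmetricAlgebra_ι_dvd (IsReduced.linearIndependent P hij fun h => ?_)
    rw [← root_reflectionPerm_self] at h
    have h1 := b.rootSign_eq_one_iff.2 (Finset.mem_filter.1 hi).2
    have h2 := b.rootSign_eq_one_iff.2 (Finset.mem_filter.1 hj).2
    rw [P.root.injective h, rootSign_neg, h2] at h1
    omega
  · intro i _
    refine b.induction_reflect i (p := fun i => ιS (P.root i) ∣ f) ?_ ?_ ?_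
    · intro i hi
      rwa [root_reflectionPerm_self, map_neg, neg_dvd]
    · intro s hs
      have h := P.ι_mul_demazureEnd s f
      rw [hf s hs, sub_neg_eq_add, ← two_smul ℂ] at h
      refine ⟨(2 : ℂ)⁻¹ • P.demazureEnd s f, ?_⟩
      rw [mul_smul_comm, h, smul_smul, inv_mul_cancel₀ two_ne_zero, one_smul]
    · intro i s hi hs
      have h := map_dvd (P.weylSym (weylGroup.ofIdx P s)) hi
      rwa [hf s hs, dvd_neg, weylSym_ι, ofIdx_smul_vec, ← root_reflectionPerm] at h

open Classical in
lemma weylSym_posProd {s : ι} (hs : s ∈ b.support) :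
    P.weylSym (weylGroup.ofIdx P s) b.posProd = -b.posProd := by
  have hmem : s ∈ Finset.univ.filter (fun i => b.IsPos i) :=
    Finset.mem_filter.2 ⟨Finset.mem_univ _, isPos_of_mem_support hs⟩
  have hmaps : ∀ i ∈ (Finset.univ.filter (fun i => b.IsPos i)).erase s,
      P.reflectionPerm s i ∈ (Finset.univ.filter (fun i => b.IsPos i)).erase s := by
    intro i hi
    simp only [Finset.mem_erase, Finset.mem_filter, Finset.mem_univ, true_and] at hi ⊢
    refine ⟨fun h => ?_, hi.2.reflectionPerm hs hi.1⟩
    have h1 := b.rootSign_eq_one_iff.2 hi.2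
    rw [← P.reflectionPerm_self s i, h, rootSign_neg, b.rootSign_of_mem hs] at h1
    omega
  rw [posProd, map_prod, ← Finset.mul_prod_erase _ _ hmem, ← Finset.mul_prod_erase _ _ hmem,
    ← neg_mul]
  congr 1
  · rw [weylSym_ι, ofIdx_smul_vec, reflection_apply_self, map_neg]
  · refine Finset.prod_nbij' (P.reflectionPerm s) (P.reflectionPerm s) hmaps hmaps
      (fun i _ => P.reflectionPerm_self s i) (fun i _ => P.reflectionPerm_self s i) fun i _ => ?_
    rw [weylSym_ι, ofIdx_smul_vec, root_reflectionPerm]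

lemma neg_one_pow_length_ofIdx_mul {s : ι} (hs : s ∈ b.support) (w : P.weylGroup) :
    (-1 : ℂ) ^ b.length (weylGroup.ofIdx P s * w) = -(-1) ^ b.length w := by
  obtain ⟨l, rfl⟩ := b.exists_wordProd_eq w
  have h1 := b.length_wordProd_mod_two l
  have h2 := b.length_wordProd_mod_two (⟨s, hs⟩ :: l)
  rw [wordProd_cons, List.length_cons] at h2
  rw [neg_one_pow_eq_pow_mod_two, neg_one_pow_eq_pow_mod_two (n := b.length (b.wordProd l)), h2, h1,
    ← neg_one_pow_eq_pow_mod_two, ← neg_one_pow_eq_pow_mod_two, pow_succ]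
  ring

lemma weylSym_posProd_eq (w : P.weylGroup) :
    P.weylSym w b.posProd = (-1 : ℂ) ^ b.length w • b.posProd := by
  obtain ⟨l, rfl⟩ := b.exists_wordProd_eq w
  induction l with
  | nil => simp [weylSym_one, length_one]
  | cons s l ih =>
    rw [wordProd_cons, weylSym_mul, ih, map_smul, b.weylSym_posProd s.2,
      b.neg_one_pow_length_ofIdx_mul s.2, neg_smul, smul_neg]

omit [P.IsCrystallographic] [P.IsReduced] in
lemma posProd_ne_zero : b.posProd ≠ 0 :=
  Finset.prod_ne_zero_iff.2 fun i _ => P.ι_root_ne_zero i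

variable [Fintype P.weylGroup]

lemma posProd_dvd_sum (f : S) :
    b.posProd ∣ ∑ w : P.weylGroup, (-1 : ℂ) ^ b.length w • P.weylSym w f := by
  refine b.posProd_dvd fun s hs => ?_
  rw [map_sum, ← Equiv.sum_comp (Equiv.mulLeft (weylGroup.ofIdx P s)), ← Finset.sum_neg_distrib]
  refine Finset.sum_congr rfl fun w _ => ?_
  rw [Equiv.coe_mulLeft, map_smul, ← weylSym_mul, ← mul_assoc, ofIdx_mul_self, one_mul,
    b.neg_one_pow_length_ofIdx_mul hs, neg_smul]

/-- Antisymmetrization is linear over invariants, so a generator of I_W factors out and contributes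
a factor vanishing at 0. -/
lemma exists_sum_eq_posProd_mul {f : S} (hf : f ∈ P.coinvariantIdeal) (a : S) :
    ∃ h : S, SymmetricAlgebra.algebraMapInv h = 0 ∧
      ∑ w : P.weylGroup, (-1 : ℂ) ^ b.length w • P.weylSym w (a * f) = b.posProd * h := by
  induction hf using Submodule.span_induction generalizing a with
  | mem f hf =>
    obtain ⟨j, hj, hf, hw⟩ := hf
    obtain ⟨h, hh⟩ := b.posProd_dvd_sum a
    refine ⟨h * f, ?_, ?_⟩
    · rw [map_mul, algebraMapInv_of_mem_symPower (by omega) hf, mul_zero]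
    · rw [← mul_assoc, ← hh, Finset.sum_mul]
      simp only [map_mul, hw, smul_mul_assoc]
  | zero => exact ⟨0, by simp, by simp⟩
  | add x y _ _ hx hy =>
    obtain ⟨h, h1, h2⟩ := hx a
    obtain ⟨k, k1, k2⟩ := hy a
    refine ⟨h + k, by rw [map_add, h1, k1, add_zero], ?_⟩
    rw [mul_add b.posProd, ← h2, ← k2, ← Finset.sum_add_distrib]
    simp only [mul_add, map_add, smul_add]
  | smul r x _ hx =>
    obtain ⟨h, h1, h2⟩ := hx (a * r)
    exact ⟨h, h1, by rw [← h2, smul_eq_mul, mul_assoc]⟩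

end Alternating

/-- Antisymmetrizing the product multiplies it by |W|; were it in I_W, cancelling it would make the
constant |W| vanish at 0. -/
lemma posProd_notMem_coinvariantIdeal [P.IsRootSystem] : b.posProd ∉ P.coinvariantIdeal := by
  intro hmem
  have := P.finite_weylGroup
  have := Fintype.ofFinite P.weylGroup
  obtain ⟨h, h1, h2⟩ := b.exists_sum_eq_posProd_mul hmem 1
  have h3 : ∀ w : P.weylGroup, (-1 : ℂ) ^ b.length w • P.weylSym w (1 * b.posProd) = b.posProd := by
    intro w
    rw [one_mul, weylSym_posProd_eq, smul_smul, ← mul_pow]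
    simp
  simp only [h3, Finset.sum_const, nsmul_eq_mul] at h2
  rw [mul_comm] at h2
  have h4 := mul_left_cancel₀ b.posProd_ne_zero h2
  rw [← h4, map_natCast, Nat.cast_eq_zero, Finset.card_univ] at h1
  exact Fintype.card_ne_zero h1

section Longest

variable [P.IsRootSystem] {w₀ : P.weylGroup} (hw₀ : ∀ w, b.length w ≤ b.length w₀)

omit [P.IsCrystallographic] [P.IsReduced] [P.IsRootSystem] in
lemma topElement_eq : b.topElement = (Nat.card P.weylGroup : ℂ)⁻¹ • b.posProd := rfl

include hw₀ in
omit [P.IsRootSystem] in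
lemma topElement_mem_symPower : b.topElement ∈ symPower V (b.length w₀) := by
  classical
  rw [topElement_eq, ← b.card_isPos hw₀]
  exact Submodule.smul_mem _ _ (prod_ι_mem_symPower _ _)

include hw₀ in
-- Some word form is nonzero on D, as D is not in I_W. Degree forces that word to have length ℓ(w₀),
-- and nonvanishing forces it to be reduced, so its product is w₀.
lemma wordForm_topElement_ne_zero {l : List b.support} (hl : b.wordProd l = w₀)
    (hlen : l.length = b.length w₀) : b.wordForm l b.topElement ≠ 0 := by
  have := P.finite_weylGroup
  have hcard : (Nat.card P.weylGroup : ℂ)⁻¹ ≠ 0 := inv_ne_zero (Nat.cast_ne_zero.2 Nat.card_pos.ne')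
  obtain ⟨m, hm⟩ : ∃ m, b.wordForm m b.topElement ≠ 0 := by
    by_contra! h
    refine b.posProd_notMem_coinvariantIdeal (b.mem_coinvariantIdeal_iff.2 fun m => ?_)
    have := h m
    rw [topElement_eq, map_smul] at this
    exact (smul_eq_zero.1 this).resolve_left hcard
  have h1 : b.length w₀ = m.length := by
    by_contra hne
    exact hm (b.wordForm_of_mem_symPower hne (b.topElement_mem_symPower hw₀))
  have h2 : b.length (b.wordProd m) = m.length := by
    refine (b.length_wordProd_le m).antisymm (not_lt.1 fun hlt => hm ?_)
    rw [wordForm_apply, b.wordEnd_eq_zero hlt, LinearMap.zero_apply, map_zero]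
  have h3 := b.eq_longest hw₀ (h2.trans h1.symm)
  rwa [wordForm_apply, b.wordEnd_congr (hlen.trans h1) (hl.trans h3.symm)]

end Longest

end Base

end RootPairing

/-! ### The grading of the coinvariant algebra. -/

namespace RootPairing

variable {ι V V' : Type*} [AddCommGroup V] [Module ℂ V] [AddCommGroup V'] [Module ℂ V']

local notation "S" => SymmetricAlgebra ℂ V

section Grading

variable (P : RootPairing ι ℂ V V')

lemma mk_mem_coinvariantGrading {j : ℕ} {k : ℤ} (hk : 2 * (j : ℤ) = k) {f : S}
    (hf : f ∈ symPower V j) : Ideal.Quotient.mk P.coinvariantIdeal f ∈ P.coinvariantGrading k :=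
  Submodule.mem_iSup_of_mem j (Submodule.mem_iSup_of_mem hk ⟨f, hf, rfl⟩)

lemma exists_of_mem_coinvariantGrading {k : ℤ} {x : P.Coinvariant}
    (hx : x ∈ P.coinvariantGrading k) :
    x = 0 ∨ ∃ j : ℕ, 2 * (j : ℤ) = k ∧ ∃ f ∈ symPower V j,
      Ideal.Quotient.mk P.coinvariantIdeal f = x := by
  by_cases h : ∃ j : ℕ, 2 * (j : ℤ) = k
  · obtain ⟨j, rfl⟩ := h
    refine Or.inr ⟨j, rfl, ?_⟩
    have h1 : P.coinvariantGrading (2 * (j : ℤ)) ≤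
        (symPower V j).map (Ideal.Quotient.mkₐ ℂ P.coinvariantIdeal).toLinearMap := by
      refine iSup₂_le fun i hi => ?_
      obtain rfl : i = j := by omega
      exact le_rfl
    exact h1 hx
  · left
    have h1 : P.coinvariantGrading k ≤ ⊥ := iSup₂_le fun i hi => absurd ⟨i, hi⟩ h
    exact (Submodule.mem_bot ℂ).1 (h1 hx)

lemma one_mem_coinvariantGrading : (1 : P.Coinvariant) ∈ P.coinvariantGrading 0 :=
  P.mk_mem_coinvariantGrading (j := 0) (f := 1) (by norm_num) one_mem_symPower_zero

lemma mul_mem_coinvariantGrading {k l : ℤ} {x y : P.Coinvariant}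
    (hx : x ∈ P.coinvariantGrading k) (hy : y ∈ P.coinvariantGrading l) :
    x * y ∈ P.coinvariantGrading (k + l) := by
  rcases P.exists_of_mem_coinvariantGrading hx with rfl | ⟨i, rfl, f, hf, rfl⟩
  · rw [zero_mul]; exact zero_mem _
  rcases P.exists_of_mem_coinvariantGrading hy with rfl | ⟨j, rfl, g, hg, rfl⟩
  · rw [mul_zero]; exact zero_mem _
  rw [← map_mul]
  exact P.mk_mem_coinvariantGrading (by push_cast; ring) (mul_mem_symPower hf hg)

lemma gradedMonoid_coinvariantGrading : SetLike.GradedMonoid P.coinvariantGrading where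
  one_mem := P.one_mem_coinvariantGrading
  mul_mem _ _ _ _ := P.mul_mem_coinvariantGrading

end Grading

/-! ### The Schubert basis, the trace form and the cell datum. -/

namespace Base

variable {P : RootPairing ι ℂ V V'} (b : P.Base)
variable [Fintype ι] [P.IsCrystallographic] [P.IsReduced]

lemma wordProd_reducedWord (w : P.weylGroup) : b.wordProd (b.reducedWord w) = w :=
  (b.exists_reducedWord w).choose_spec.1

lemma length_reducedWord (w : P.weylGroup) : (b.reducedWord w).length = b.length w :=
  (b.exists_reducedWord w).choose_spec.2

/-- The linear form `f ↦ (Δ_w f)(0)` on the coinvariant algebra. -/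
noncomputable def coinvariantForm (w : P.weylGroup) : P.Coinvariant →ₗ[ℂ] ℂ where
  toFun := QuotientAddGroup.lift P.coinvariantIdeal.toAddSubgroup
    (b.wordForm (b.reducedWord w)).toAddMonoidHom
    fun _ hf => b.wordForm_of_mem_coinvariantIdeal _ hf
  map_add' x y := map_add _ x y
  map_smul' r x := by
    obtain ⟨f, rfl⟩ := Ideal.Quotient.mk_surjective x
    exact map_smul (b.wordForm (b.reducedWord w)) r f

lemma coinvariantForm_mk (w : P.weylGroup) (f : S) :
    b.coinvariantForm w (Ideal.Quotient.mk P.coinvariantIdeal f) =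
      b.wordForm (b.reducedWord w) f := rfl

lemma coinvariantForm_one_mk (f : S) :
    b.coinvariantForm 1 (Ideal.Quotient.mk P.coinvariantIdeal f) =
      SymmetricAlgebra.algebraMapInv f := by
  have h := b.length_reducedWord 1
  rw [length_one, List.length_eq_zero_iff] at h
  rw [coinvariantForm_mk, h, wordForm_apply, wordEnd_nil, Module.End.one_apply]

lemma coinvariantForm_of_mem (w : P.weylGroup) {k : ℤ} (hk : k ≠ 2 * (b.length w : ℤ))
    {x : P.Coinvariant} (hx : x ∈ P.coinvariantGrading k) : b.coinvariantForm w x = 0 := by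
  rcases P.exists_of_mem_coinvariantGrading hx with rfl | ⟨i, rfl, f, hf, rfl⟩
  · exact map_zero _
  · refine b.wordForm_of_mem_symPower ?_ hf
    rw [length_reducedWord]
    omega

section Longest

variable {w₀ : P.weylGroup} (hw₀ : ∀ w, b.length w ≤ b.length w₀)

include hw₀

lemma schubertRep_mem_symPower (w : P.weylGroup) :
    b.demazure (w⁻¹ * w₀) b.topElement ∈ symPower V (b.length w) := by
  rw [demazure, demazureWord_eq]
  refine b.wordEnd_mem_symPower _ ?_
  rw [length_reducedWord, b.length_inv_mul_longest hw₀]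
  exact b.topElement_mem_symPower hw₀

lemma schubert_mem_coinvariantGrading (w : P.weylGroup) :
    b.schubert w₀ w ∈ P.coinvariantGrading (2 * (b.length w : ℤ)) :=
  P.mk_mem_coinvariantGrading rfl (b.schubertRep_mem_symPower hw₀ w)

lemma coinvariantForm_schubert_self (v : P.weylGroup) :
    b.coinvariantForm v (b.schubert w₀ v) = b.wordForm (b.reducedWord w₀) b.topElement := by
  rw [schubert, coinvariantForm_mk, demazure, demazureWord_eq, wordForm_apply,
    ← Module.End.mul_apply, ← wordEnd_append, wordForm_apply]
  congr 2
  refine b.wordEnd_congr ?_ ?_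
  · have := b.length_inv_mul_longest hw₀ v
    simp only [List.length_append, length_reducedWord]
    omega
  · simp [wordProd_append, wordProd_reducedWord]

/-- The concatenated word either has the wrong length for the degree of D, or has length ℓ(w₀) and
product different from w₀, hence is not reduced. -/
lemma coinvariantForm_schubert_of_ne {v u : P.weylGroup} (h : v ≠ u) :
    b.coinvariantForm v (b.schubert w₀ u) = 0 := by
  rw [schubert, coinvariantForm_mk, demazure, demazureWord_eq, wordForm_apply,
    ← Module.End.mul_apply, ← wordEnd_append, ← wordForm_apply]
  set L := b.reducedWord v ++ b.reducedWord (u⁻¹ * w₀) with hL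
  by_cases hlen : b.length w₀ = L.length
  · have h1 : b.wordProd L ≠ w₀ := by
      rw [hL, wordProd_append, wordProd_reducedWord, wordProd_reducedWord, ← mul_assoc]
      intro h2
      exact h (mul_inv_eq_one.1 (mul_eq_right.1 h2))
    have h2 : b.length (b.wordProd L) < L.length :=
      lt_of_le_of_ne (b.length_wordProd_le L) fun h3 => h1 (b.eq_longest hw₀ (h3.trans hlen.symm))
    rw [wordForm_apply, b.wordEnd_eq_zero h2, LinearMap.zero_apply, map_zero]
  · exact b.wordForm_of_mem_symPower hlen (b.topElement_mem_symPower hw₀)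

/-- Write Δ_{w₀} = Δ_m Δ_s. As Δ_s is linear over s-invariants, Δ_s(Δ_s f · g) = Δ_s f · Δ_s g =
Δ_s(f · Δ_s g). -/
lemma wordForm_longest_demazureEnd_mul (s : b.support) (f g : S) :
    b.wordForm (b.reducedWord w₀) (P.demazureEnd (s : ι) f * g) =
      b.wordForm (b.reducedWord w₀) (f * P.demazureEnd (s : ι) g) := by
  obtain ⟨m, hm, hlen⟩ := b.exists_reducedWord (w₀ * weylGroup.ofIdx P (s : ι))
  have hprod : b.wordProd (m ++ [s]) = w₀ := by
    rw [wordProd_append, hm, wordProd_cons, wordProd_nil, mul_one, mul_assoc, ofIdx_mul_self,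
      mul_one]
  have h1 := b.length_wordProd_mod_two (m ++ [s])
  have h2 := b.length_wordProd_le (m ++ [s])
  have h3 := hw₀ (w₀ * weylGroup.ofIdx P (s : ι))
  rw [hprod, List.length_append, List.length_singleton] at h1 h2
  have h4 : b.wordEnd (b.reducedWord w₀) = b.wordEnd (m ++ [s]) := by
    refine b.wordEnd_congr ?_ ?_
    -- Since ℓ(w₀) ≤ |m| + 1 ≤ ℓ(w₀) + 1, parity excludes the upper bound.
    · rw [length_reducedWord, List.length_append, List.length_singleton]
      omega
    · rw [wordProd_reducedWord, hprod]
  simp only [wordForm_apply, h4, wordEnd_append, wordEnd_cons, wordEnd_nil, mul_one,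
    Module.End.mul_apply]
  rw [P.demazureEnd_mul_of_invariant (P.weylSym_demazureEnd s f), mul_comm f,
    P.demazureEnd_mul_of_invariant (P.weylSym_demazureEnd s g), mul_comm]

lemma wordForm_longest_wordEnd_mul (l : List b.support) (f g : S) :
    b.wordForm (b.reducedWord w₀) (b.wordEnd l f * g) =
      b.wordForm (b.reducedWord w₀) (f * b.wordEnd l.reverse g) := by
  induction l generalizing g with
  | nil => rfl
  | cons s l ih =>
    rw [wordEnd_cons, Module.End.mul_apply, b.wordForm_longest_demazureEnd_mul hw₀, ih,
      List.reverse_cons, wordEnd_append, wordEnd_cons, wordEnd_nil, mul_one, Module.End.mul_apply]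

/-- D already has the only degree that the form sees, so just the constant term of f survives. -/
lemma wordForm_longest_mul_topElement (f : S) :
    b.wordForm (b.reducedWord w₀) (f * b.topElement) =
      SymmetricAlgebra.algebraMapInv f * b.wordForm (b.reducedWord w₀) b.topElement := by
  have hf : f ∈ ⨆ j, symPower V j := by rw [iSup_symPower]; trivial
  induction hf using Submodule.iSup_induction' with
  | mem j f hf =>
    rcases Nat.eq_zero_or_pos j with rfl | hj
    · rw [mem_symPower_zero hf, ← Algebra.smul_def, map_smul,
        SymmetricAlgebra.algebraMap_leftInverse, smul_eq_mul]
    · rw [algebraMapInv_of_mem_symPower hj.ne' hf, zero_mul]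
      refine b.wordForm_of_mem_symPower ?_ (mul_mem_symPower hf (b.topElement_mem_symPower hw₀))
      rw [length_reducedWord]
      omega
  | zero => simp
  | add x y _ _ hx hy => rw [add_mul, map_add, map_add, hx, hy, add_mul]

variable [P.IsRootSystem]

omit hw₀ in
lemma eq_zero_of_coinvariantForm {x : P.Coinvariant} (h : ∀ w, b.coinvariantForm w x = 0) :
    x = 0 := by
  obtain ⟨f, rfl⟩ := Ideal.Quotient.mk_surjective x
  rw [Ideal.Quotient.eq_zero_iff_mem, b.mem_coinvariantIdeal_iff]
  intro l
  rcases (b.length_wordProd_le l).lt_or_eq with hl | hl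
  · rw [wordForm_apply, b.wordEnd_eq_zero hl, LinearMap.zero_apply, map_zero]
  · rw [wordForm_apply, b.wordEnd_congr (l' := b.reducedWord (b.wordProd l))
      (by rw [length_reducedWord, hl]) (by rw [wordProd_reducedWord])]
    exact h (b.wordProd l)

lemma wordForm_longest_topElement_ne_zero :
    b.wordForm (b.reducedWord w₀) b.topElement ≠ 0 :=
  b.wordForm_topElement_ne_zero hw₀ (b.wordProd_reducedWord w₀) (b.length_reducedWord w₀)

lemma eq_sum_schubert [Fintype P.weylGroup] (x : P.Coinvariant) :
    x = ∑ w, ((b.wordForm (b.reducedWord w₀) b.topElement)⁻¹ * b.coinvariantForm w x) •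
      b.schubert w₀ w := by
  classical
  rw [← sub_eq_zero]
  refine b.eq_zero_of_coinvariantForm fun v => ?_
  rw [map_sub, map_sum, Finset.sum_eq_single_of_mem v (Finset.mem_univ v), map_smul,
    b.coinvariantForm_schubert_self hw₀, smul_eq_mul, mul_right_comm,
    inv_mul_cancel₀ (b.wordForm_longest_topElement_ne_zero hw₀), one_mul, sub_self]
  intro u _ hu
  rw [map_smul, b.coinvariantForm_schubert_of_ne hw₀ hu.symm, smul_zero]

lemma linearIndependent_schubert : LinearIndependent ℂ (b.schubert w₀) := by
  rw [linearIndependent_iff']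
  intro t g hg v hv
  have h := congrArg (b.coinvariantForm v) hg
  rw [map_sum, map_zero, Finset.sum_eq_single_of_mem v hv, map_smul,
    b.coinvariantForm_schubert_self hw₀] at h
  · exact (smul_eq_zero.1 h).resolve_right (b.wordForm_longest_topElement_ne_zero hw₀)
  · intro u _ hu
    rw [map_smul, b.coinvariantForm_schubert_of_ne hw₀ hu.symm, smul_zero]

lemma span_schubert : Submodule.span ℂ (Set.range (b.schubert w₀)) = ⊤ := by
  have := P.finite_weylGroup
  have := Fintype.ofFinite P.weylGroup
  refine Submodule.eq_top_iff'.2 fun x => ?_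
  rw [b.eq_sum_schubert hw₀ x]
  exact Submodule.sum_mem _ fun w _ => Submodule.smul_mem _ _ (Submodule.subset_span ⟨w, rfl⟩)

lemma isAlgebraGrading_coinvariantGrading : IsAlgebraGrading P.coinvariantGrading := by
  refine ⟨P.gradedMonoid_coinvariantGrading,
    (DirectSum.isInternal_submodule_iff_iSupIndep_and_iSup_eq_top _).2 ⟨fun k => ?_, ?_⟩⟩
  · rw [Submodule.disjoint_def]
    intro x hx hx'
    refine b.eq_zero_of_coinvariantForm fun w => ?_
    by_cases hk : k = 2 * (b.length w : ℤ)
    · have h1 : ⨆ j, ⨆ (_ : j ≠ k), P.coinvariantGrading j ≤ LinearMap.ker (b.coinvariantForm w) :=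
        iSup₂_le fun j hj y hy => b.coinvariantForm_of_mem w (hk ▸ hj) hy
      exact h1 hx'
    · exact b.coinvariantForm_of_mem w hk hx
  · rw [← top_le_iff, ← b.span_schubert hw₀, Submodule.span_le]
    rintro _ ⟨w, rfl⟩
    exact Submodule.mem_iSup_of_mem _ (b.schubert_mem_coinvariantGrading hw₀ w)

/-- Constants act by scalars; a factor of positive degree raises the degree, so only classes of
longer elements can occur. -/
lemma schubert_mul_sub_mem (w : P.weylGroup) (a : P.Coinvariant) :
    b.schubert w₀ w * a - b.coinvariantForm 1 a • b.schubert w₀ w ∈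
      Submodule.span ℂ (b.schubert w₀ '' {v | b.length w < b.length v}) := by
  have := P.finite_weylGroup
  have := Fintype.ofFinite P.weylGroup
  obtain ⟨f, rfl⟩ := Ideal.Quotient.mk_surjective a
  have hf : f ∈ ⨆ j, symPower V j := by rw [iSup_symPower]; trivial
  induction hf using Submodule.iSup_induction' with
  | mem j f hf =>
    rw [coinvariantForm_one_mk]
    rcases Nat.eq_zero_or_pos j with rfl | hj
    · have h : Ideal.Quotient.mk P.coinvariantIdeal f =
          algebraMap ℂ P.Coinvariant (SymmetricAlgebra.algebraMapInv f) :=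
        congrArg (Ideal.Quotient.mk P.coinvariantIdeal) (mem_symPower_zero hf)
      rw [h, mul_comm, ← Algebra.smul_def, sub_self]
      exact zero_mem _
    · rw [algebraMapInv_of_mem_symPower hj.ne' hf, zero_smul, sub_zero, schubert, ← map_mul,
        b.eq_sum_schubert hw₀ (Ideal.Quotient.mk _ _)]
      refine Submodule.sum_mem _ fun v _ => ?_
      by_cases hv : b.length w < b.length v
      · exact Submodule.smul_mem _ _ (Submodule.subset_span ⟨v, hv, rfl⟩)
      · rw [coinvariantForm_mk, b.wordForm_of_mem_symPower _
          (mul_mem_symPower (b.schubertRep_mem_symPower hw₀ w) hf), mul_zero, zero_smul]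
        · exact zero_mem _
        · rw [length_reducedWord]
          omega
  | zero => simp
  | add x y _ _ hx hy =>
    rw [map_add, mul_add, map_add, add_smul, add_sub_add_comm]
    exact add_mem hx hy

/-- The form `X_w ↦ δ_{w,w₀}` on the coinvariant algebra. -/
lemma exists_schubert_trace : ∃ tr : P.Coinvariant →ₗ[ℂ] ℂ,
    tr (b.schubert w₀ w₀) = 1 ∧ (∀ w, w ≠ w₀ → tr (b.schubert w₀ w) = 0) ∧
    IsSymmetrizingForm tr ∧
    IsHomogeneousForm P.coinvariantGrading tr (-2 * (b.length w₀ : ℤ)) := by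
  have hc := b.wordForm_longest_topElement_ne_zero hw₀
  refine ⟨(b.wordForm (b.reducedWord w₀) b.topElement)⁻¹ • b.coinvariantForm w₀, ?_, ?_,
    ⟨fun x y => by rw [mul_comm], fun x hx => ?_⟩, ?_⟩
  · rw [LinearMap.smul_apply, b.coinvariantForm_schubert_self hw₀, smul_eq_mul, inv_mul_cancel₀ hc]
  · intro w hw
    rw [LinearMap.smul_apply, b.coinvariantForm_schubert_of_ne hw₀ hw.symm, smul_zero]
  · refine b.eq_zero_of_coinvariantForm fun v => ?_
    obtain ⟨f, rfl⟩ := Ideal.Quotient.mk_surjective x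
    -- The test element is Δ_{v⁻¹} D. Moving the operators across by adjointness turns the pairing
    -- into the value at 0 of Δ_v f.
    have h := hx (Ideal.Quotient.mk _ (b.wordEnd (b.reducedWord v).reverse b.topElement))
    rw [LinearMap.smul_apply, ← map_mul, coinvariantForm_mk,
      ← b.wordForm_longest_wordEnd_mul hw₀, b.wordForm_longest_mul_topElement hw₀, smul_eq_mul,
      mul_left_comm, inv_mul_cancel₀ hc, mul_one] at h
    exact h
  · intro k hk x hx
    rw [LinearMap.smul_apply, b.coinvariantForm_of_mem w₀ (by omega) hx, smul_zero]

end Longest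

/-- The partial order on the Weyl group comparing lengths. -/
@[reducible] def lengthOrder : PartialOrder P.weylGroup where
  le u v := u = v ∨ b.length u < b.length v
  lt u v := b.length u < b.length v
  le_refl _ := Or.inl rfl
  le_trans u v w huv hvw := by
    rcases huv with rfl | huv
    · exact hvw
    · rcases hvw with rfl | hvw
      · exact Or.inr huv
      · exact Or.inr (huv.trans hvw)
  lt_iff_le_not_ge u v := by
    refine ⟨fun h => ⟨Or.inr h, ?_⟩, fun ⟨h, h'⟩ => h.resolve_left fun e => h' (Or.inl e.symm)⟩
    rintro (rfl | h')
    · exact h.false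
    · exact h.asymm h'
  le_antisymm u v huv hvu := by
    rcases huv with rfl | huv
    · rfl
    · rcases hvu with rfl | hvu
      · rfl
      · exact absurd hvu huv.asymm

/-- The graded cell datum of the Schubert basis of the coinvariant algebra. -/
@[reducible] noncomputable def schubertCellDatum [P.IsRootSystem] {w₀ : P.weylGroup}
    (hw₀ : ∀ w, b.length w ≤ b.length w₀) :
    letI := b.lengthOrder
    GradedCellDatum P.coinvariantGrading P.weylGroup :=
  letI := b.lengthOrder
  { isGrading := b.isAlgebraGrading_coinvariantGrading hw₀
    moduleFinite := by
      have := P.finite_weylGroup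
      exact ⟨⟨(Set.finite_range (b.schubert w₀)).toFinset, by
        rw [Set.Finite.coe_toFinset, b.span_schubert hw₀]⟩⟩
    T := fun _ => Unit
    finiteT := fun _ => inferInstance
    c := fun w _ _ => b.schubert w₀ w
    deg := fun w _ => b.length w
    c_mem := fun w _ _ => by
      rw [← two_mul]
      exact b.schubert_mem_coinvariantGrading hw₀ w
    linearIndependent_c := (b.linearIndependent_schubert hw₀).comp
      (fun x : (_ : P.weylGroup) × (Unit × Unit) => x.1) fun x y h => by
        obtain ⟨w, ⟨⟩, ⟨⟩⟩ := x
        obtain ⟨w', ⟨⟩, ⟨⟩⟩ := y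
        obtain rfl : w = w' := h
        rfl
    span_c := by
      rw [← b.span_schubert hw₀]
      congr 1
      ext x
      exact ⟨fun ⟨y, hy⟩ => ⟨y.1, hy⟩, fun ⟨w, hw⟩ => ⟨⟨w, (), ()⟩, hw⟩⟩
    c_mul := fun w _ a => by
      -- The form of the identity element is the constant term, so C acts on every cell module
      -- through evaluation at 0.
      refine ⟨fun _ => b.coinvariantForm 1 a, fun _ => ?_⟩
      rw [finsum_eq_sum_of_fintype, Fintype.sum_unique]
      refine Submodule.span_mono ?_ (b.schubert_mul_sub_mem hw₀ w a)
      rintro _ ⟨v, hv, rfl⟩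
      exact ⟨v, hv, (), (), rfl⟩
    anti := ⟨LinearMap.id, fun _ _ _ => rfl, fun x y => mul_comm x y⟩ }

end Base

end RootPairing

theorem mainTheorem10 {ι V V' : Type*} [Fintype ι]
    [AddCommGroup V] [Module ℂ V] [AddCommGroup V'] [Module ℂ V']
    (P : RootPairing ι ℂ V V') [P.IsRootSystem] [P.IsCrystallographic] [P.IsReduced]
    (b : P.Base) (w₀ : P.weylGroup) (hw₀ : ∀ w, b.length w ≤ b.length w₀) :
    (∃ (_ : PartialOrder P.weylGroup) (D : GradedCellDatum P.coinvariantGrading P.weylGroup),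
      (∀ w (s t : D.T w), D.c w s t = b.schubert w₀ w) ∧
      (∀ w (t : D.T w), D.deg w t = b.length w) ∧
      (∀ w, Module.finrank ℂ (D.CellModule w) = 1)) ∧
    (∃ tr : P.Coinvariant →ₗ[ℂ] ℂ,
      tr (b.schubert w₀ w₀) = 1 ∧ (∀ w, w ≠ w₀ → tr (b.schubert w₀ w) = 0) ∧
      IsSymmetrizingForm tr ∧
      IsHomogeneousForm P.coinvariantGrading tr (-2 * (b.length w₀ : ℤ)) ∧
      ∀ tr' : P.Coinvariant →ₗ[ℂ] ℂ,
        tr' (b.schubert w₀ w₀) = 1 → (∀ w, w ≠ w₀ → tr' (b.schubert w₀ w) = 0) →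
          tr' = tr) := by
  refine ⟨⟨b.lengthOrder, b.schubertCellDatum hw₀, fun _ _ _ => rfl, fun _ _ => rfl, fun w => ?_⟩,
    ?_⟩
  · let := b.lengthOrder
    have h := Module.finrank_eq_card_basis
      ((b.schubertCellDatum hw₀).cellBasis w : Module.Basis Unit ℂ _)
    rwa [Fintype.card_unit] at h
  · obtain ⟨tr, h1, h2, h3, h4⟩ := b.exists_schubert_trace hw₀
    refine ⟨tr, h1, h2, h3, h4, fun tr' h1' h2' => ?_⟩
    refine LinearMap.ext_on_range (b.span_schubert hw₀) fun w => ?_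
    by_cases hw : w = w₀
    · rw [hw, h1, h1']
    · rw [h2 w hw, h2' w hw]
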